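/- Let $(M^3,g)$ be a connected smooth Riemannian $3$-manifold and let $f:M\to\mathbb{E}^4$ be a smooth isometric immersion into Euclidean $4$-space with second fundamental form $h$. For $x\in M$ and an orthonormal basis $e_1,e_2,e_3$ of $T_xM$ let $\rho(x)=\frac13\sum_{i<j}K(e_i\wedge e_j)$ be the normalized scalar curvature of $g$ ($K$ the sectional curvature) and $\mathcal C_x=\frac13\sum_{i,j=1}^3\|h(e_i,e_j)\|^2$ the Casorati curvature. For a plane $L\subset T_xM$ with orthonormal basis $v_1,v_2$ let $\mathcal C(L)=\frac12\sum_{i,j=1}^2\|h(v_i,v_j)\|^2$, and let $$[\delta_C(2)]_x=\tfrac12\,\mathcal C_x+\tfrac23\,\inf\{\mathcal C(L)\mid L\text{ a plane in }T_xM\}.$$ (One always has $\rho\le\delta_C(2)$.) Suppose that $f$ is Casorati ideal, i.e. $\rho(x)=[\delta_C(2)]_x$ for every $x\in M$, and that $f$ is not totally geodesic, i.e. $h\not\equiv0$. Then $f$ is rigid: for every smooth isometric immersion $f':M\to\mathbb{E}^4$ there is an isometry $\Phi$ of $\mathbb{E}^4$ with $f'=\Phi\circ f$. -/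

import Mathlib

open scoped Manifold ContDiff
open Module Bundle

noncomputable section

namespace Casorati

/-- Euclidean space of dimension `n`. -/
abbrev E (n : ℕ) : Type := EuclideanSpace ℝ (Fin n)

/-- The `i`-th standard basis vector of Euclidean space. -/
def stdVec {n : ℕ} (i : Fin n) : E n := EuclideanSpace.single i 1

/-- The `i`-th partial derivative of a real function on Euclidean space. -/
def partialDeriv {n : ℕ} (i : Fin n) (φ : E n → ℝ) (y : E n) : ℝ := fderiv ℝ φ y (stdVec i)

section Manifold

variable {n : ℕ} {M : Type*} [TopologicalSpace M] [ChartedSpace (E n) M]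

instance (x : M) : FiniteDimensional ℝ (TangentSpace (𝓡 n) x) :=
  inferInstanceAs (FiniteDimensional ℝ (E n))

/-- The coordinates of a tangent vector at `x` with respect to the chart at `x`. -/
def coord (x : M) (u : TangentSpace (𝓡 n) x) : E n :=
  mfderiv (𝓡 n) (𝓡 n) (extChartAt (𝓡 n) x) x u

/-- The `i`-th coordinate vector field of the chart at `x`, at the point with coordinates `y`. -/
def coordField (x : M) (y : E n) (i : Fin n) :
    TangentSpace (𝓡 n) ((extChartAt (𝓡 n) x).symm y) :=
  mfderiv (𝓡 n) (𝓡 n) (extChartAt (𝓡 n) x).symm y (stdVec i)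

/-! ### Intrinsic curvature of a Riemannian manifold -/

section Intrinsic

variable [IsManifold (𝓡 n) ∞ M] [RiemannianBundle (fun x : M ↦ TangentSpace (𝓡 n) x)]

/-- The matrix `g_{ij}` of the metric in the chart at `x`, at the point with coordinates `y`. -/
def metricMatrix (x : M) (y : E n) : Matrix (Fin n) (Fin n) ℝ :=
  Matrix.of fun i j ↦ inner ℝ (coordField x y i) (coordField x y j)

/-- The Christoffel symbol `Γ^k_{ij}` of the Levi-Civita connection in the chart at `x`. -/
def christoffel (x : M) (k i j : Fin n) (y : E n) : ℝ :=
  (1 / 2) * ∑ l, (metricMatrix x y)⁻¹ k l *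
    (partialDeriv i (fun z ↦ metricMatrix x z j l) y
      + partialDeriv j (fun z ↦ metricMatrix x z i l) y
      - partialDeriv l (fun z ↦ metricMatrix x z i j) y)

/-- The component `R^i_{jkl}` at `x`, in the chart at `x`, of the curvature tensor
`R(X, Y) Z = ∇_X ∇_Y Z - ∇_Y ∇_X Z - ∇_{[X, Y]} Z`, that is `R(∂_k, ∂_l) ∂_j = ∑ i, R^i_{jkl} ∂_i`. -/
def curvatureCoeff (x : M) (i j k l : Fin n) : ℝ :=
  let p : E n := extChartAt (𝓡 n) x x
  partialDeriv k (christoffel x i l j) p - partialDeriv l (christoffel x i k j) p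
    + ∑ m, (christoffel x i k m p * christoffel x m l j p
      - christoffel x i l m p * christoffel x m k j p)

/-- The curvature tensor `g(R(u, v) w, z)` on tangent vectors at `x`. -/
def curvatureTensor (x : M) (u v w z : TangentSpace (𝓡 n) x) : ℝ :=
  ∑ i, ∑ j, ∑ k, ∑ l, ∑ m, metricMatrix x (extChartAt (𝓡 n) x x) m i *
    curvatureCoeff x i j k l * coord x z m * coord x w j * coord x u k * coord x v l

/-- The sectional curvature `K(u ∧ v)` of the plane spanned by `u` and `v`. -/
def sectionalCurvature (x : M) (u v : TangentSpace (𝓡 n) x) : ℝ :=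
  curvatureTensor x u v v u / (inner ℝ u u * inner ℝ v v - inner ℝ u v ^ 2)

variable (n) in
/-- The scalar curvature `τ = ∑_{i < j} K(e_i ∧ e_j)`, for an orthonormal basis of the tangent
space (the value does not depend on the basis). -/
def scalarCurvature (x : M) : ℝ :=
  let e := stdOrthonormalBasis ℝ (TangentSpace (𝓡 n) x)
  ∑ i, ∑ j, if i < j then sectionalCurvature x (e i) (e j) else 0

variable (n) in
/-- The normalized scalar curvature `ρ = 2 τ / (n (n - 1))`. -/
def normalizedScalarCurvature (x : M) : ℝ :=
  2 * scalarCurvature n x / ((n : ℝ) * ((n : ℝ) - 1))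

end Intrinsic

/-! ### Second fundamental form and Casorati curvatures of an immersion into Euclidean space -/

section Extrinsic

variable {m : ℕ}

/-- The second fundamental form: the normal component of the second derivative of `f`
read in the chart at `x`. -/
def secondFundamentalForm (f : M → E m) (x : M) (u v : TangentSpace (𝓡 n) x) : E m :=
  let F : E n → E m := f ∘ (extChartAt (𝓡 n) x).symm
  let p : E n := extChartAt (𝓡 n) x x
  (LinearMap.range (fderiv ℝ F p : E n →ₗ[ℝ] E m))ᗮ.starProjection
    (fderiv ℝ (fderiv ℝ F) p (coord x u) (coord x v))

variable (n) in
/-- An immersion is totally geodesic if its second fundamental form vanishes identically. -/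
def IsTotallyGeodesic (f : M → E m) : Prop :=
  ∀ (x : M) (u v : TangentSpace (𝓡 n) x), secondFundamentalForm f x u v = 0

variable [IsManifold (𝓡 n) ∞ M] [RiemannianBundle (fun x : M ↦ TangentSpace (𝓡 n) x)]

variable (n) in
/-- Smooth isometric immersions of a Riemannian `n`-manifold into Euclidean `m`-space. -/
def IsIsometricImmersion (f : M → E m) : Prop :=
  ContMDiff (𝓡 n) (𝓡 m) ∞ f ∧
    ∀ (x : M) (u v : TangentSpace (𝓡 n) x),
      inner ℝ (mfderiv (𝓡 n) (𝓡 m) f x u) (mfderiv (𝓡 n) (𝓡 m) f x v) = inner ℝ u v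

variable (n) in
/-- The Casorati curvature `C = (1 / n) ∑_{i, j} ‖h(e_i, e_j)‖ ^ 2` at `x`, for an orthonormal basis
of the tangent space (the value does not depend on the basis). -/
def casoratiCurvature (f : M → E m) (x : M) : ℝ :=
  let e := stdOrthonormalBasis ℝ (TangentSpace (𝓡 n) x)
  (1 / (n : ℝ)) * ∑ i, ∑ j, ‖secondFundamentalForm f x (e i) (e j)‖ ^ 2

/-- The Casorati curvature `C(L) = (1 / dim L) ∑_{i, j} ‖h(e_i, e_j)‖ ^ 2` of a subspace `L` of the
tangent space, for an orthonormal basis of `L` (the value does not depend on the basis). -/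
def casoratiCurvatureOn (f : M → E m) (x : M) (L : Submodule ℝ (TangentSpace (𝓡 n) x)) : ℝ :=
  let e := stdOrthonormalBasis ℝ L
  (1 / (finrank ℝ L : ℝ)) *
    ∑ i, ∑ j, ‖secondFundamentalForm f x (e i : TangentSpace (𝓡 n) x) (e j)‖ ^ 2

variable (n) in
/-- The normalized `δ`-Casorati curvature
`δ_C(n - 1) = C / 2 + (n + 1) / (2 n) * inf {C(L) | L a hyperplane of the tangent space}`. -/
def deltaCasorati (f : M → E m) (x : M) : ℝ :=
  (1 / 2) * casoratiCurvature n f x + ((n : ℝ) + 1) / (2 * n) *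
    sInf {c : ℝ | ∃ L : Submodule ℝ (TangentSpace (𝓡 n) x),
      finrank ℝ L + 1 = n ∧ c = casoratiCurvatureOn f x L}

variable (n) in
/-- Casorati ideal immersions into Euclidean space: the inequality `ρ ≤ δ_C(n - 1)` is an equality
at every point (the ambient sectional curvature is `0`). -/
def IsCasoratiIdeal (f : M → E m) : Prop :=
  ∀ x : M, normalizedScalarCurvature n x = deltaCasorati n f x

variable (n) in
/-- An isometric immersion is rigid if every isometric immersion of the same Riemannian manifold
into the same Euclidean space differs from it by an isometry of the ambient space. -/
def IsRigid (f : M → E m) : Prop :=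
  ∀ f' : M → E m, IsIsometricImmersion n f' → ∃ Φ : E m ≃ᵢ E m, ∀ x, f' x = Φ (f x)

end Extrinsic

end Manifold

end Casorati

end

/-!
Equality in the Casorati inequality, with the infimum attained on a hyperplane orthogonal to a unit
vector `t`, forces the second fundamental form to be `(⟪u, v⟫ + ⟪u, t⟫⟪v, t⟫) η`: the principal
curvatures are `(a, …, a, 2 a)`. By the Codazzi equation `a ^ 4 + ‖∇a‖ ^ 2` is locally constant
away from the zeros of `a`, and `∇a` vanishes at every zero of `a`; so `a` vanishes identically or
nowhere on a connected hypersurface, and an ideal immersion which is not totally geodesic has no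
geodesic points. Its second fundamental form then has rank at least three everywhere, and the Gauss
equation determines it up to sign, so that any two immersions are locally congruent (Beez–Killing).
The ambient isometry is unique near a point which is not geodesic, hence locally constant on `M`,
hence constant.
-/

noncomputable section

namespace Casorati

open scoped RealInnerProductSpace Topology

/-! ### Calculus and immersions -/

section Calculus

variable {V W : Type*} [NormedAddCommGroup V] [NormedSpace ℝ V] {s : Set V} {y : V}

section NormedSpace

variable [NormedAddCommGroup W] [NormedSpace ℝ W] {φ ψ : V → W}

lemma contDiffOn_fderiv (hs : IsOpen s) (h : ContDiffOn ℝ ∞ φ s) :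
    ContDiffOn ℝ ∞ (fderiv ℝ φ) s :=
  h.fderiv_of_isOpen hs (by simp)

lemma hasFDerivAt_of_contDiffOn (hs : IsOpen s) (h : ContDiffOn ℝ ∞ φ s) (hy : y ∈ s) :
    HasFDerivAt φ (fderiv ℝ φ y) y :=
  ((h.contDiffAt (hs.mem_nhds hy)).differentiableAt (by simp)).hasFDerivAt

lemma hasFDerivAt_fderiv_apply (hs : IsOpen s) (h : ContDiffOn ℝ ∞ φ s) (hy : y ∈ s) (u : V) :
    HasFDerivAt (fun z ↦ fderiv ℝ φ z u) ((fderiv ℝ (fderiv ℝ φ) y).flip u) y := by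
  simpa using (hasFDerivAt_of_contDiffOn hs (contDiffOn_fderiv hs h) hy).clm_apply
    (hasFDerivAt_const u y)

lemma fderiv_fderiv_comm (hs : IsOpen s) (h : ContDiffOn ℝ ∞ φ s) (hy : y ∈ s) (u v : V) :
    fderiv ℝ (fderiv ℝ φ) y u v = fderiv ℝ (fderiv ℝ φ) y v u := by
  refine (h.contDiffAt (hs.mem_nhds hy)).isSymmSndFDerivAt ?_ u v
  rw [minSmoothness_of_isRCLikeNormedField]
  exact WithTop.coe_le_coe.2 le_top

lemma hasFDerivAt_unique_of_eqOn (hs : IsOpen s) (heq : Set.EqOn φ ψ s) (hy : y ∈ s)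
    {A B : V →L[ℝ] W} (hφ : HasFDerivAt φ A y) (hψ : HasFDerivAt ψ B y) : A = B :=
  hφ.unique (hψ.congr_of_eventuallyEq (heq.eventuallyEq_of_mem (hs.mem_nhds hy)))

end NormedSpace

variable [NormedAddCommGroup W] [InnerProductSpace ℝ W] {φ ψ : V → W}

lemma inner_add_inner_eq_zero_of_inner_const (hs : IsOpen s) (hy : y ∈ s) {A B : V →L[ℝ] W}
    (hφ : HasFDerivAt φ A y) (hψ : HasFDerivAt ψ B y) {c : ℝ} (hc : ∀ z ∈ s, ⟪φ z, ψ z⟫ = c)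
    (w : V) : ⟪φ y, B w⟫ + ⟪A w, ψ y⟫ = 0 := by
  have h := hasFDerivAt_unique_of_eqOn hs hc hy (hφ.inner ℝ hψ) (hasFDerivAt_const c y)
  simpa using DFunLike.congr_fun h w

end Calculus

section Immersion

variable {V W : Type*} [NormedAddCommGroup V] [NormedSpace ℝ V]
  [NormedAddCommGroup W] [InnerProductSpace ℝ W] {Ω : Set V} {F : V → W} {y : V}

/-- A smooth immersion, in the sense of the differential being injective, on an open set. -/
structure IsImmersionOn (Ω : Set V) (F : V → W) : Prop where
  isOpen : IsOpen Ω
  contDiffOn : ContDiffOn ℝ ∞ F Ω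
  injective : ∀ y ∈ Ω, Function.Injective (fderiv ℝ F y)

/-- The covector `v ↦ ⟪w, dF v⟫` attached to a vector `w` along a map `F`. -/
def pullbackCovector (F : V → W) (y : V) : W →L[ℝ] V →L[ℝ] ℝ :=
  ((ContinuousLinearMap.compL ℝ V W ℝ).flip (fderiv ℝ F y)).comp (innerSL ℝ)

/-- The first fundamental form of a map `F`. -/
def firstForm (F : V → W) (y : V) : V →L[ℝ] V →L[ℝ] ℝ :=
  (pullbackCovector F y).comp (fderiv ℝ F y)

/-- For an immersion `F`, the tangential component of a vector along `F`, read in the domain through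
the differential of `F`. -/
def tangentPart (F : V → W) (y : V) : W →L[ℝ] V :=
  (firstForm F y).inverse.comp (pullbackCovector F y)

/-- The tangential component of the second derivative, read in the domain: in coordinates these are
the Christoffel symbols `Γ(u, v)` of the induced metric. -/
def connectionForm (F : V → W) (y u v : V) : V :=
  tangentPart F y (fderiv ℝ (fderiv ℝ F) y u v)

/-- The second fundamental form of a map between vector spaces: the normal component of the second
derivative. -/
def secondForm (F : V → W) (y u v : V) : W :=
  fderiv ℝ (fderiv ℝ F) y u v - fderiv ℝ F y (connectionForm F y u v)

@[simp]
lemma pullbackCovector_apply (F : V → W) (y : V) (w : W) (v : V) :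
    pullbackCovector F y w v = ⟪w, fderiv ℝ F y v⟫ := by
  simp [pullbackCovector]

@[simp]
lemma firstForm_apply (F : V → W) (y u v : V) :
    firstForm F y u v = ⟪fderiv ℝ F y u, fderiv ℝ F y v⟫ := by
  simp [firstForm]

lemma tangentPart_eq_zero {w : W} (hw : ∀ v, ⟪w, fderiv ℝ F y v⟫ = 0) : tangentPart F y w = 0 := by
  have : pullbackCovector F y w = 0 := by ext v; simpa using hw v
  simp [tangentPart, this]

namespace IsImmersionOn

lemma mono (h : IsImmersionOn Ω F) {Ω' : Set V} (ho : IsOpen Ω') (hs : Ω' ⊆ Ω) :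
    IsImmersionOn Ω' F where
  isOpen := ho
  contDiffOn := h.contDiffOn.mono hs
  injective y hy := h.injective y (hs hy)

lemma hasFDerivAt (h : IsImmersionOn Ω F) (hy : y ∈ Ω) : HasFDerivAt F (fderiv ℝ F y) y :=
  hasFDerivAt_of_contDiffOn h.isOpen h.contDiffOn hy

lemma hasFDerivAt_fderiv (h : IsImmersionOn Ω F) (hy : y ∈ Ω) (u : V) :
    HasFDerivAt (fun z ↦ fderiv ℝ F z u) ((fderiv ℝ (fderiv ℝ F) y).flip u) y :=
  hasFDerivAt_fderiv_apply h.isOpen h.contDiffOn hy u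

lemma fderiv_fderiv_comm (h : IsImmersionOn Ω F) (hy : y ∈ Ω) (u v : V) :
    fderiv ℝ (fderiv ℝ F) y u v = fderiv ℝ (fderiv ℝ F) y v u :=
  Casorati.fderiv_fderiv_comm h.isOpen h.contDiffOn hy u v

lemma fderiv_firstForm_apply (h : IsImmersionOn Ω F) (hy : y ∈ Ω) (u v w : V) :
    fderiv ℝ (fun z ↦ firstForm F z u v) y w =
      ⟪fderiv ℝ (fderiv ℝ F) y w u, fderiv ℝ F y v⟫ +
        ⟪fderiv ℝ F y u, fderiv ℝ (fderiv ℝ F) y w v⟫ := by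
  have hd := (h.hasFDerivAt_fderiv hy u).inner ℝ (h.hasFDerivAt_fderiv hy v)
  simp only [firstForm_apply, hd.fderiv]
  simp [add_comm]

lemma koszul (h : IsImmersionOn Ω F) (hy : y ∈ Ω) (u v w : V) :
    2 * ⟪fderiv ℝ (fderiv ℝ F) y u v, fderiv ℝ F y w⟫ =
      fderiv ℝ (fun z ↦ firstForm F z v w) y u + fderiv ℝ (fun z ↦ firstForm F z u w) y v -
        fderiv ℝ (fun z ↦ firstForm F z u v) y w := by
  simp only [h.fderiv_firstForm_apply hy, h.fderiv_fderiv_comm hy w, h.fderiv_fderiv_comm hy v u,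
    real_inner_comm (fderiv ℝ F y v)]
  ring

lemma fderiv_ne_zero (h : IsImmersionOn Ω F) (hy : y ∈ Ω) {u : V} (hu : u ≠ 0) :
    fderiv ℝ F y u ≠ 0 :=
  (map_ne_zero_iff _ (h.injective y hy)).2 hu

lemma inner_fderiv_self_pos (h : IsImmersionOn Ω F) (hy : y ∈ Ω) {u : V} (hu : u ≠ 0) :
    0 < ⟪fderiv ℝ F y u, fderiv ℝ F y u⟫ :=
  real_inner_self_pos.2 (h.fderiv_ne_zero hy hu)

set_option synthInstance.maxHeartbeats 200000 in
-- Instances on iterated spaces of continuous linear maps are slow to find.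
lemma contDiffOn_pullbackCovector (h : IsImmersionOn Ω F) :
    ContDiffOn ℝ ∞ (pullbackCovector F) Ω := by
  have hcomp : ContDiff ℝ ∞ (ContinuousLinearMap.compL ℝ V W ℝ).flip :=
    ContinuousLinearMap.contDiff _
  exact (hcomp.comp_contDiffOn (contDiffOn_fderiv h.isOpen h.contDiffOn)).clm_comp contDiffOn_const

variable [FiniteDimensional ℝ V]

lemma exists_firstForm_equiv (h : IsImmersionOn Ω F) (hy : y ∈ Ω) :
    ∃ e : V ≃L[ℝ] (V →L[ℝ] ℝ), (e : V →L[ℝ] V →L[ℝ] ℝ) = firstForm F y := by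
  have hinj : Function.Injective (firstForm F y).toLinearMap := by
    refine (injective_iff_map_eq_zero _).2 fun u hu ↦ h.injective y hy ?_
    simpa using DFunLike.congr_fun hu u
  have hdim : finrank ℝ V = finrank ℝ (V →L[ℝ] ℝ) := by
    rw [← (LinearMap.toContinuousLinearMap : (V →ₗ[ℝ] ℝ) ≃ₗ[ℝ] V →L[ℝ] ℝ).finrank_eq]
    exact (Subspace.dual_finrank_eq (K := ℝ) (V := V)).symm
  exact ⟨(LinearEquiv.ofInjectiveOfFinrankEq _ hinj hdim).toContinuousLinearEquiv, by ext; rfl⟩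

lemma firstForm_tangentPart (h : IsImmersionOn Ω F) (hy : y ∈ Ω) (w : W) :
    firstForm F y (tangentPart F y w) = pullbackCovector F y w := by
  obtain ⟨e, he⟩ := h.exists_firstForm_equiv hy
  simp [tangentPart, ← he]

lemma inner_fderiv_tangentPart (h : IsImmersionOn Ω F) (hy : y ∈ Ω) (w : W) (v : V) :
    ⟪fderiv ℝ F y (tangentPart F y w), fderiv ℝ F y v⟫ = ⟪w, fderiv ℝ F y v⟫ := by
  simpa using DFunLike.congr_fun (h.firstForm_tangentPart hy w) v

lemma tangentPart_fderiv (h : IsImmersionOn Ω F) (hy : y ∈ Ω) (u : V) :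
    tangentPart F y (fderiv ℝ F y u) = u := by
  obtain ⟨e, he⟩ := h.exists_firstForm_equiv hy
  change (firstForm F y).inverse (firstForm F y u) = u
  simp [← he]

lemma contDiffOn_tangentPart (h : IsImmersionOn Ω F) : ContDiffOn ℝ ∞ (tangentPart F) Ω := by
  have hdF := contDiffOn_fderiv h.isOpen h.contDiffOn
  have hcov := h.contDiffOn_pullbackCovector
  refine ContDiffOn.clm_comp (fun y hy ↦ ?_) hcov
  obtain ⟨e, he⟩ := h.exists_firstForm_equiv hy
  have hinv := contDiffAt_map_inverse (n := ∞) e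
  rw [he] at hinv
  exact hinv.comp_contDiffWithinAt y (hcov.clm_comp hdF y hy)

lemma connectionForm_congr {W' : Type*} [NormedAddCommGroup W'] [InnerProductSpace ℝ W']
    {G : V → W'} (h : IsImmersionOn Ω F) (h' : IsImmersionOn Ω G)
    (hg : Set.EqOn (firstForm F) (firstForm G) Ω) (hy : y ∈ Ω) (u v : V) :
    connectionForm F y u v = connectionForm G y u v := by
  obtain ⟨e, he⟩ := h.exists_firstForm_equiv hy
  have hfderiv (u v : V) :
      fderiv ℝ (fun z ↦ firstForm F z u v) y = fderiv ℝ (fun z ↦ firstForm G z u v) y :=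
    ((hg.eventuallyEq_of_mem (h.isOpen.mem_nhds hy)).fun_comp fun B ↦ B u v).fderiv_eq
  suffices firstForm F y (connectionForm F y u v) = firstForm F y (connectionForm G y u v) by
    rw [← he] at this
    exact e.injective this
  ext w
  have hF := h.koszul hy u v w
  have hG := h'.koszul hy u v w
  nth_rw 2 [hg hy]
  rw [connectionForm, connectionForm, h.firstForm_tangentPart hy, h'.firstForm_tangentPart hy,
    pullbackCovector_apply, pullbackCovector_apply]
  simp only [hfderiv] at hF
  linarith

lemma inner_sub_fderiv_tangentPart (h : IsImmersionOn Ω F) (hy : y ∈ Ω) (w : W) (v : V) :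
    ⟪w - fderiv ℝ F y (tangentPart F y w), fderiv ℝ F y v⟫ = 0 := by
  rw [inner_sub_left, h.inner_fderiv_tangentPart hy, sub_self]

lemma inner_secondForm_fderiv (h : IsImmersionOn Ω F) (hy : y ∈ Ω) (u v w : V) :
    ⟪secondForm F y u v, fderiv ℝ F y w⟫ = 0 :=
  h.inner_sub_fderiv_tangentPart hy _ w

end IsImmersionOn

lemma fderiv_connectionForm_add_secondForm (F : V → W) (y u v : V) :
    fderiv ℝ F y (connectionForm F y u v) + secondForm F y u v = fderiv ℝ (fderiv ℝ F) y u v :=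
  add_sub_cancel _ _

lemma secondForm_eq_starProjection [FiniteDimensional ℝ V] (h : IsImmersionOn Ω F) (hy : y ∈ Ω)
    (u v : V) : secondForm F y u v =
      (LinearMap.range (fderiv ℝ F y : V →ₗ[ℝ] W))ᗮ.starProjection
        (fderiv ℝ (fderiv ℝ F) y u v) := by
  refine (Submodule.eq_starProjection_of_mem_orthogonal ?_ ?_).symm
  · rw [Submodule.mem_orthogonal]
    rintro _ ⟨w, rfl⟩
    rw [real_inner_comm]
    exact h.inner_secondForm_fderiv hy u v w
  · rw [secondForm, sub_sub_cancel]
    exact Submodule.le_orthogonal_orthogonal _ ⟨_, rfl⟩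

end Immersion

section FramedHypersurface

variable {V W : Type*} [NormedAddCommGroup V] [NormedSpace ℝ V]
  [NormedAddCommGroup W] [InnerProductSpace ℝ W] {Ω : Set V} {F N : V → W} {y : V}

/-- A smooth parametrised hypersurface `F` over an open set, together with a smooth unit normal
field `N`. That the image is a hypersurface is expressed by the tangent space being the whole
orthogonal complement of the normal. -/
structure FramedHypersurface (Ω : Set V) (F N : V → W) : Prop extends IsImmersionOn Ω F where
  contDiffOn_normal : ContDiffOn ℝ ∞ N Ω
  norm_normal : ∀ y ∈ Ω, ‖N y‖ = 1
  range_fderiv : ∀ y ∈ Ω, LinearMap.range (fderiv ℝ F y : V →ₗ[ℝ] W) = (ℝ ∙ N y)ᗮ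

set_option synthInstance.maxHeartbeats 200000 in
-- Instances on iterated spaces of continuous linear maps are slow to find.
/-- The scalar second fundamental form `⟪D²F(u, v), N⟫` of a hypersurface `F` with unit normal
field `N`. -/
def normalForm (F N : V → W) (y : V) : V →L[ℝ] V →L[ℝ] ℝ :=
  (ContinuousLinearMap.compL ℝ V W ℝ (innerSL ℝ (N y))).comp (fderiv ℝ (fderiv ℝ F) y)

@[simp]
lemma normalForm_apply (u v : V) :
    normalForm F N y u v = ⟪fderiv ℝ (fderiv ℝ F) y u v, N y⟫ := by
  simp [normalForm, real_inner_comm]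

lemma normalForm_neg_apply (u v : V) : normalForm F (-N) y u v = -normalForm F N y u v := by
  simp

namespace FramedHypersurface

lemma mono (h : FramedHypersurface Ω F N) {Ω' : Set V} (ho : IsOpen Ω') (hs : Ω' ⊆ Ω) :
    FramedHypersurface Ω' F N where
  toIsImmersionOn := h.toIsImmersionOn.mono ho hs
  contDiffOn_normal := h.contDiffOn_normal.mono hs
  norm_normal y hy := h.norm_normal y (hs hy)
  range_fderiv y hy := h.range_fderiv y (hs hy)

lemma neg (h : FramedHypersurface Ω F N) : FramedHypersurface Ω F (-N) where
  toIsImmersionOn := h.toIsImmersionOn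
  contDiffOn_normal := h.contDiffOn_normal.neg
  norm_normal y hy := by simpa using h.norm_normal y hy
  range_fderiv y hy := by
    rw [h.range_fderiv y hy, Pi.neg_apply, ← Set.neg_singleton, Submodule.span_neg]

lemma inner_fderiv_normal (h : FramedHypersurface Ω F N) (hy : y ∈ Ω) (u : V) :
    ⟪fderiv ℝ F y u, N y⟫ = 0 := by
  have hu : fderiv ℝ F y u ∈ (ℝ ∙ N y)ᗮ := h.range_fderiv y hy ▸ ⟨u, rfl⟩
  rw [real_inner_comm]
  exact Submodule.mem_orthogonal_singleton_iff_inner_right.1 hu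

lemma inner_normal_fderiv (h : FramedHypersurface Ω F N) (hy : y ∈ Ω) (u : V) :
    ⟪N y, fderiv ℝ F y u⟫ = 0 := by
  rw [real_inner_comm, h.inner_fderiv_normal hy]

lemma inner_normal_self (h : FramedHypersurface Ω F N) (hy : y ∈ Ω) : ⟪N y, N y⟫ = 1 := by
  simp [h.norm_normal y hy]

lemma tangentPart_normal (h : FramedHypersurface Ω F N) (hy : y ∈ Ω) :
    tangentPart F y (N y) = 0 :=
  tangentPart_eq_zero (h.inner_normal_fderiv hy)

lemma hasFDerivAt_normal (h : FramedHypersurface Ω F N) (hy : y ∈ Ω) :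
    HasFDerivAt N (fderiv ℝ N y) y :=
  hasFDerivAt_of_contDiffOn h.isOpen h.contDiffOn_normal hy

lemma hasFDerivAt_fderiv_normal (h : FramedHypersurface Ω F N) (hy : y ∈ Ω) (u : V) :
    HasFDerivAt (fun z ↦ fderiv ℝ N z u) ((fderiv ℝ (fderiv ℝ N) y).flip u) y :=
  hasFDerivAt_fderiv_apply h.isOpen h.contDiffOn_normal hy u

lemma fderiv_fderiv_normal_comm (h : FramedHypersurface Ω F N) (hy : y ∈ Ω) (u v : V) :
    fderiv ℝ (fderiv ℝ N) y u v = fderiv ℝ (fderiv ℝ N) y v u :=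
  Casorati.fderiv_fderiv_comm h.isOpen h.contDiffOn_normal hy u v

lemma inner_normal_fderiv_normal (h : FramedHypersurface Ω F N) (hy : y ∈ Ω) (w : V) :
    ⟪N y, fderiv ℝ N y w⟫ = 0 := by
  have := inner_add_inner_eq_zero_of_inner_const h.isOpen hy (h.hasFDerivAt_normal hy)
    (h.hasFDerivAt_normal hy) (fun z hz ↦ h.inner_normal_self hz) w
  rw [real_inner_comm (N y)] at this
  linarith

lemma weingarten (h : FramedHypersurface Ω F N) (hy : y ∈ Ω) (u v : V) :
    ⟪fderiv ℝ (fderiv ℝ F) y u v, N y⟫ = -⟪fderiv ℝ F y v, fderiv ℝ N y u⟫ := by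
  have := inner_add_inner_eq_zero_of_inner_const h.isOpen hy (h.hasFDerivAt_fderiv hy v)
    (h.hasFDerivAt_normal hy) (fun z hz ↦ h.inner_fderiv_normal hz v) u
  rw [ContinuousLinearMap.flip_apply] at this
  linarith

lemma inner_fderiv_fderiv_normal_comm (h : FramedHypersurface Ω F N) (hy : y ∈ Ω) (u v : V) :
    ⟪fderiv ℝ F y u, fderiv ℝ N y v⟫ = ⟪fderiv ℝ F y v, fderiv ℝ N y u⟫ := by
  have hu := h.weingarten hy u v
  have hv := h.weingarten hy v u
  rw [h.fderiv_fderiv_comm hy] at hu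
  linarith

set_option synthInstance.maxHeartbeats 200000 in
-- Instances on iterated spaces of continuous linear maps are slow to find.
lemma continuousOn_normalForm (h : FramedHypersurface Ω F N) :
    ContinuousOn (normalForm F N) Ω := by
  have hcovector : ContinuousOn (fun y ↦ ContinuousLinearMap.compL ℝ V W ℝ (innerSL ℝ (N y))) Ω :=
    (ContinuousLinearMap.continuous _).comp_continuousOn
      ((innerSL ℝ).continuous.comp_continuousOn h.contDiffOn_normal.continuousOn)
  exact hcovector.clm_comp
    (contDiffOn_fderiv h.isOpen (contDiffOn_fderiv h.isOpen h.contDiffOn)).continuousOn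

variable [FiniteDimensional ℝ V]

lemma fderiv_tangentPart (h : FramedHypersurface Ω F N) (hy : y ∈ Ω) {w : W} (hw : ⟪w, N y⟫ = 0) :
    fderiv ℝ F y (tangentPart F y w) = w := by
  have hmem : w ∈ LinearMap.range (fderiv ℝ F y : V →ₗ[ℝ] W) := by
    rw [h.range_fderiv y hy, Submodule.mem_orthogonal_singleton_iff_inner_left]
    exact hw
  obtain ⟨u, rfl⟩ := hmem
  exact congrArg _ (h.tangentPart_fderiv hy u)

lemma fderiv_tangentPart_add_normal (h : FramedHypersurface Ω F N) (hy : y ∈ Ω) (w : W) :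
    fderiv ℝ F y (tangentPart F y w) + ⟪w, N y⟫ • N y = w := by
  have hw := h.fderiv_tangentPart (w := w - ⟪w, N y⟫ • N y) hy
    (by simp [inner_sub_left, inner_smul_left, h.norm_normal y hy])
  rw [map_sub, map_smul, h.tangentPart_normal hy, smul_zero, sub_zero] at hw
  rw [hw, sub_add_cancel]

lemma ext_inner (h : FramedHypersurface Ω F N) (hy : y ∈ Ω) {w w' : W}
    (htangent : ∀ u, ⟪fderiv ℝ F y u, w⟫ = ⟪fderiv ℝ F y u, w'⟫)
    (hnormal : ⟪N y, w⟫ = ⟪N y, w'⟫) : w = w' := by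
  refine ext_inner_left ℝ fun z ↦ ?_
  rw [← h.fderiv_tangentPart_add_normal hy z]
  simp only [inner_add_left, inner_smul_left, htangent, hnormal]

lemma secondForm_eq (h : FramedHypersurface Ω F N) (hy : y ∈ Ω) (u v : V) :
    secondForm F y u v = normalForm F N y u v • N y := by
  rw [normalForm_apply, secondForm, sub_eq_iff_eq_add', connectionForm,
    h.fderiv_tangentPart_add_normal hy]

end FramedHypersurface

lemma range_eq_orthogonal_span_singleton [FiniteDimensional ℝ W]
    (hdim : finrank ℝ W = finrank ℝ V + 1)
    {A : V →L[ℝ] W} (hA : Function.Injective A) {n : W} (hn : n ≠ 0) (h : ∀ u, ⟪n, A u⟫ = 0) :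
    LinearMap.range (A : V →ₗ[ℝ] W) = (ℝ ∙ n)ᗮ := by
  have : Fact (finrank ℝ W = finrank ℝ V + 1) := ⟨hdim⟩
  refine Submodule.eq_of_le_of_finrank_eq ?_ ?_
  · rintro _ ⟨u, rfl⟩
    exact Submodule.mem_orthogonal_singleton_iff_inner_right.2 (h u)
  · rw [LinearMap.finrank_range_of_inj hA,
      Submodule.finrank_orthogonal_span_singleton (n := finrank ℝ V) hn]

lemma exists_ne_zero_inner_eq_zero [FiniteDimensional ℝ V] [FiniteDimensional ℝ W]
    (hdim : finrank ℝ V < finrank ℝ W)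
    (A : V →L[ℝ] W) : ∃ n : W, n ≠ 0 ∧ ∀ u, ⟪n, A u⟫ = 0 := by
  have hne : (LinearMap.range (A : V →ₗ[ℝ] W))ᗮ ≠ ⊥ := by
    intro hbot
    have hle := LinearMap.finrank_range_le (A : V →ₗ[ℝ] W)
    rw [(Submodule.orthogonal_eq_bot_iff).1 hbot, finrank_top] at hle
    exact hdim.not_ge hle
  obtain ⟨n, hn, hn0⟩ := Submodule.exists_mem_ne_zero_of_ne_bot hne
  exact ⟨n, hn0, fun u ↦ (Submodule.mem_orthogonal' _ _).1 hn _ ⟨u, rfl⟩⟩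

theorem IsImmersionOn.exists_framedHypersurface [FiniteDimensional ℝ V] [FiniteDimensional ℝ W]
    (h : IsImmersionOn Ω F) (hdim : finrank ℝ W = finrank ℝ V + 1) (hy : y ∈ Ω) :
    ∃ Ω' ⊆ Ω, y ∈ Ω' ∧ ∃ N, FramedHypersurface Ω' F N := by
  obtain ⟨n, hn, hperp⟩ := exists_ne_zero_inner_eq_zero (by lia) (fderiv ℝ F y)
  set P : V → W := fun z ↦ n - fderiv ℝ F z (tangentPart F z n) with hP
  have hPsmooth : ContDiffOn ℝ ∞ P Ω := contDiffOn_const.sub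
    ((contDiffOn_fderiv h.isOpen h.contDiffOn).clm_apply
      (h.contDiffOn_tangentPart.clm_apply contDiffOn_const))
  have hΩ' : IsOpen (Ω ∩ P ⁻¹' {0}ᶜ) :=
    hPsmooth.continuousOn.isOpen_inter_preimage h.isOpen isOpen_compl_singleton
  have hPy : P y = n := by simp [hP, tangentPart_eq_zero hperp]
  refine ⟨_, Set.inter_subset_left, ⟨hy, by simpa [hPy] using hn⟩, fun z ↦ ‖P z‖⁻¹ • P z,
    h.mono hΩ' Set.inter_subset_left, ?_, fun z hz ↦ ?_, fun z hz ↦ ?_⟩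
  · have hPsmooth' := hPsmooth.mono (Set.inter_subset_left (t := P ⁻¹' {0}ᶜ))
    exact ((hPsmooth'.norm ℝ fun z hz ↦ hz.2).inv fun z hz ↦ norm_ne_zero_iff.2 hz.2).smul
      hPsmooth'
  · exact norm_smul_inv_norm (𝕜 := ℝ) hz.2
  · refine range_eq_orthogonal_span_singleton hdim (h.injective z hz.1)
      (smul_ne_zero (inv_ne_zero (norm_ne_zero_iff.2 hz.2)) hz.2) fun u ↦ ?_
    rw [inner_smul_left, h.inner_sub_fderiv_tangentPart hz.1, mul_zero]

end FramedHypersurface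

/-! ### Hypersurfaces with principal curvatures `(a, …, a, 2 a)` -/

section IdealShape

variable {V W : Type*} [NormedAddCommGroup V] [NormedSpace ℝ V]
  [NormedAddCommGroup W] [InnerProductSpace ℝ W] {Ω : Set V} {F N : V → W} {y : V} {a : ℝ} {T : W}

/-- The shape operator of a hypersurface has principal curvatures `(a, …, a, 2 a)`, and the unit
tangent vector `T` spans a principal direction of curvature `2 a`. -/
structure HasIdealShape (F N : V → W) (a : ℝ) (T : W) (y : V) : Prop where
  norm_eq_one : ‖T‖ = 1
  inner_normal : ⟪T, N y⟫ = 0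
  fderiv_normal : ∀ u, fderiv ℝ N y u = -a • (fderiv ℝ F y u + ⟪fderiv ℝ F y u, T⟫ • T)

/-- The principal curvature `a` of a hypersurface with principal curvatures `(a, …, a, 2 a)`,
expressed through the trace of the shape operator so as to be visibly smooth. -/
def principalCurvature (F N : V → W) (y : V) : ℝ :=
  -((finrank ℝ V : ℝ) + 1)⁻¹ *
    LinearMap.trace ℝ V ((tangentPart F y).comp (fderiv ℝ N y) : V →L[ℝ] V).toLinearMap

namespace HasIdealShape

lemma fderiv_normal_eq_zero (hT : HasIdealShape F N 0 T y) (u : V) : fderiv ℝ N y u = 0 := by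
  simp [hT.fderiv_normal u]

lemma neg_inv_smul_add_eq (hT : HasIdealShape F N a T y) (ha : a ≠ 0) (u : V) :
    -(a⁻¹ • fderiv ℝ N y u + fderiv ℝ F y u) = ⟪fderiv ℝ F y u, T⟫ • T := by
  rw [hT.fderiv_normal u, smul_smul, mul_neg, inv_mul_cancel₀ ha]
  module

lemma normalize_smul (hT : HasIdealShape F N a T y) {c : ℝ} (hc : c ≠ 0) :
    HasIdealShape F N a (‖c • T‖⁻¹ • c • T) y := by
  have hsq : (|c|⁻¹ * c) * (|c|⁻¹ * c) = 1 := by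
    rw [mul_mul_mul_comm, ← mul_inv, abs_mul_abs_self, inv_mul_cancel₀ (mul_ne_zero hc hc)]
  have hcT : ‖c • T‖⁻¹ • c • T = (|c|⁻¹ * c) • T := by
    rw [norm_smul, hT.norm_eq_one, mul_one, Real.norm_eq_abs, smul_smul]
  refine ⟨norm_smul_inv_norm (𝕜 := ℝ) (smul_ne_zero hc fun h0 ↦ ?_), ?_, fun u ↦ ?_⟩
  · simpa [h0] using hT.norm_eq_one
  · simp [inner_smul_left, hT.inner_normal]
  · rw [hT.fderiv_normal u, hcT, inner_smul_right, smul_smul]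
    congr 3
    linear_combination -⟪fderiv ℝ F y u, T⟫ * hsq

variable [FiniteDimensional ℝ V]

lemma principalCurvature_eq (hT : HasIdealShape F N a T y) (h : FramedHypersurface Ω F N)
    (hy : y ∈ Ω) : principalCurvature F N y = a := by
  have hshape : ((tangentPart F y).comp (fderiv ℝ N y) : V →L[ℝ] V).toLinearMap =
      -a • (LinearMap.id +
        ((innerSL ℝ T).comp (fderiv ℝ F y)).toLinearMap.smulRight (tangentPart F y T)) := by
    ext1 u
    simp [hT.fderiv_normal, h.tangentPart_fderiv hy, real_inner_comm]
  have htrace : LinearMap.trace ℝ V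
      ((tangentPart F y).comp (fderiv ℝ N y) : V →L[ℝ] V).toLinearMap = -a * (finrank ℝ V + 1) := by
    rw [hshape, map_smul, map_add, LinearMap.trace_id, LinearMap.trace_smulRight]
    simp [h.fderiv_tangentPart hy hT.inner_normal, hT.norm_eq_one]
  rw [principalCurvature, htrace]
  field_simp

end HasIdealShape

/-- A hypersurface with principal curvatures of the form `(a, …, a, 2 a)` at every point. -/
def IsIdealOn (Ω : Set V) (F N : V → W) : Prop :=
  ∀ y ∈ Ω, ∃ a T, HasIdealShape F N a T y

variable [FiniteDimensional ℝ V]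

lemma FramedHypersurface.contDiffOn_principalCurvature (h : FramedHypersurface Ω F N) :
    ContDiffOn ℝ ∞ (principalCurvature F N) Ω := by
  let tr : (V →L[ℝ] V) →L[ℝ] ℝ := LinearMap.toContinuousLinearMap
    ((LinearMap.trace ℝ V).comp (ContinuousLinearMap.coeLM ℝ))
  exact contDiffOn_const.mul (tr.contDiff.comp_contDiffOn
    (h.contDiffOn_tangentPart.clm_comp (contDiffOn_fderiv h.isOpen h.contDiffOn_normal)))

lemma IsIdealOn.exists_hasIdealShape (hid : IsIdealOn Ω F N) (h : FramedHypersurface Ω F N)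
    (hy : y ∈ Ω) : ∃ T, HasIdealShape F N (principalCurvature F N y) T y := by
  obtain ⟨a, T, hT⟩ := hid y hy
  exact ⟨T, hT.principalCurvature_eq h hy ▸ hT⟩

/-- A framed hypersurface with principal curvatures `(a, …, a, 2 a)`, where `a` vanishes nowhere
and `T` is a smooth unit field of principal directions for `2 a`. -/
structure PrincipalFrame (Ω : Set V) (F N : V → W) (a : V → ℝ) (T : V → W) : Prop
    extends FramedHypersurface Ω F N where
  contDiffOn_curvature : ContDiffOn ℝ ∞ a Ω
  contDiffOn_direction : ContDiffOn ℝ ∞ T Ω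
  curvature_ne_zero : ∀ y ∈ Ω, a y ≠ 0
  hasIdealShape : ∀ y ∈ Ω, HasIdealShape F N (a y) (T y) y

lemma FramedHypersurface.exists_principalFrame (h : FramedHypersurface Ω F N)
    (hid : IsIdealOn Ω F N) (hy : y ∈ Ω) (ha : principalCurvature F N y ≠ 0) :
    ∃ Ω' ⊆ Ω, y ∈ Ω' ∧ ∃ T, PrincipalFrame Ω' F N (principalCurvature F N) T := by
  set a := principalCurvature F N
  obtain ⟨T₀, hT₀⟩ := hid.exists_hasIdealShape h hy
  set v := tangentPart F y T₀
  -- `P z = ⟪dF v, T⟫ • T` for both choices `±T` of the principal direction at `z`.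
  let P : V → W := fun z ↦ -((a z)⁻¹ • fderiv ℝ N z v + fderiv ℝ F z v)
  have hU : IsOpen (Ω ∩ a ⁻¹' {0}ᶜ) :=
    h.contDiffOn_principalCurvature.continuousOn.isOpen_inter_preimage h.isOpen
      isOpen_compl_singleton
  have hF := h.mono hU Set.inter_subset_left
  have hasmooth : ContDiffOn ℝ ∞ a (Ω ∩ a ⁻¹' {0}ᶜ) := hF.contDiffOn_principalCurvature
  have hPsmooth : ContDiffOn ℝ ∞ P (Ω ∩ a ⁻¹' {0}ᶜ) :=
    (((hasmooth.inv fun z hz ↦ hz.2).smul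
      ((contDiffOn_fderiv hU hF.contDiffOn_normal).clm_apply contDiffOn_const)).add
      ((contDiffOn_fderiv hU hF.contDiffOn).clm_apply contDiffOn_const)).neg
  have hΩ' := hPsmooth.continuousOn.isOpen_inter_preimage hU
    (isOpen_compl_singleton (x := (0 : W)))
  have hPy : P y = T₀ := by
    change -((a y)⁻¹ • fderiv ℝ N y v + fderiv ℝ F y v) = T₀
    rw [hT₀.neg_inv_smul_add_eq ha, h.fderiv_tangentPart hy hT₀.inner_normal,
      real_inner_self_eq_norm_sq, hT₀.norm_eq_one, one_pow, one_smul]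
  have hPy0 : P y ≠ 0 := by rw [hPy, ← norm_ne_zero_iff, hT₀.norm_eq_one]; exact one_ne_zero
  have hPsmooth' := hPsmooth.mono (Set.inter_subset_left (t := P ⁻¹' {0}ᶜ))
  refine ⟨Ω ∩ a ⁻¹' {0}ᶜ ∩ P ⁻¹' {0}ᶜ, fun z hz ↦ hz.1.1, ⟨⟨hy, ha⟩, hPy0⟩,
    fun z ↦ ‖P z‖⁻¹ • P z,
    hF.mono hΩ' Set.inter_subset_left, hasmooth.mono Set.inter_subset_left,
    ((hPsmooth'.norm ℝ fun z hz ↦ hz.2).inv fun z hz ↦ norm_ne_zero_iff.2 hz.2).smul hPsmooth',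
    fun z hz ↦ hz.1.2, fun z hz ↦ ?_⟩
  obtain ⟨T, hT⟩ := hid.exists_hasIdealShape h hz.1.1
  have hPz : P z = ⟪fderiv ℝ F z v, T⟫ • T := hT.neg_inv_smul_add_eq hz.1.2 v
  rw [hPz]
  exact hT.normalize_smul fun h0 ↦ hz.2 (by simp [hPz, h0])

end IdealShape

/-! ### The Codazzi equation and the first integral -/

section StructureEquations

variable {V W : Type*} [NormedAddCommGroup V] [NormedSpace ℝ V]
  [NormedAddCommGroup W] [InnerProductSpace ℝ W] {Ω : Set V} {F N : V → W} {y : V}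

lemma exists_ne_zero_apply_eq_zero [FiniteDimensional ℝ V] (hV : 3 ≤ finrank ℝ V)
    (α β : V →L[ℝ] ℝ) : ∃ v ≠ 0, α v = 0 ∧ β v = 0 := by
  have hker : LinearMap.ker (α.prod β).toLinearMap ≠ ⊥ :=
    LinearMap.ker_ne_bot_of_finrank_lt (by simpa)
  obtain ⟨v, hv, hv0⟩ := Submodule.exists_mem_ne_zero_of_ne_bot hker
  have hpair : (α v, β v) = (0, 0) := hv
  exact ⟨v, hv0, by simpa using hpair⟩

namespace PrincipalFrame

variable {a : V → ℝ} {T : V → W}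

lemma hasFDerivAt_curvature (h : PrincipalFrame Ω F N a T) (hy : y ∈ Ω) :
    HasFDerivAt a (fderiv ℝ a y) y :=
  hasFDerivAt_of_contDiffOn h.isOpen h.contDiffOn_curvature hy

lemma hasFDerivAt_direction (h : PrincipalFrame Ω F N a T) (hy : y ∈ Ω) :
    HasFDerivAt T (fderiv ℝ T y) y :=
  hasFDerivAt_of_contDiffOn h.isOpen h.contDiffOn_direction hy

lemma inner_direction_self (h : PrincipalFrame Ω F N a T) (hy : y ∈ Ω) : ⟪T y, T y⟫ = 1 := by
  simp [(h.hasIdealShape y hy).norm_eq_one]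

lemma inner_direction_normal (h : PrincipalFrame Ω F N a T) (hy : y ∈ Ω) : ⟪T y, N y⟫ = 0 :=
  (h.hasIdealShape y hy).inner_normal

lemma fderiv_normal (h : PrincipalFrame Ω F N a T) (hy : y ∈ Ω) (u : V) :
    fderiv ℝ N y u = -a y • (fderiv ℝ F y u + ⟪fderiv ℝ F y u, T y⟫ • T y) :=
  (h.hasIdealShape y hy).fderiv_normal u

lemma inner_direction_fderiv_direction (h : PrincipalFrame Ω F N a T) (hy : y ∈ Ω) (w : V) :
    ⟪T y, fderiv ℝ T y w⟫ = 0 := by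
  have := inner_add_inner_eq_zero_of_inner_const h.isOpen hy (h.hasFDerivAt_direction hy)
    (h.hasFDerivAt_direction hy) (fun z hz ↦ h.inner_direction_self hz) w
  rw [real_inner_comm (T y)] at this
  linarith

lemma inner_normal_fderiv_direction (h : PrincipalFrame Ω F N a T) (hy : y ∈ Ω) (w : V) :
    ⟪N y, fderiv ℝ T y w⟫ = 2 * a y * ⟪fderiv ℝ F y w, T y⟫ := by
  have := inner_add_inner_eq_zero_of_inner_const h.isOpen hy (h.hasFDerivAt_normal hy)
    (h.hasFDerivAt_direction hy)
    (fun z hz ↦ by rw [real_inner_comm, h.inner_direction_normal hz]) w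
  simp only [h.fderiv_normal hy, inner_smul_left, inner_add_left, h.inner_direction_self hy,
    RCLike.conj_to_real] at this
  linarith

lemma hasFDerivAt_inner_direction (h : PrincipalFrame Ω F N a T) (hy : y ∈ Ω) (v : V) :
    HasFDerivAt (fun z ↦ ⟪fderiv ℝ F z v, T z⟫) ((innerSL ℝ (T y)).comp
      ((fderiv ℝ (fderiv ℝ F) y).flip v) + (innerSL ℝ (fderiv ℝ F y v)).comp (fderiv ℝ T y)) y := by
  refine ((h.hasFDerivAt_fderiv hy v).inner ℝ (h.hasFDerivAt_direction hy)).congr_fderiv ?_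
  ext1 w
  simp [real_inner_comm (T y), add_comm]

lemma codazzi (h : PrincipalFrame Ω F N a T) (hy : y ∈ Ω) (u v : V) :
    fderiv ℝ a y u • (fderiv ℝ F y v + ⟪fderiv ℝ F y v, T y⟫ • T y) +
      a y • (⟪fderiv ℝ F y v, fderiv ℝ T y u⟫ • T y + ⟪fderiv ℝ F y v, T y⟫ • fderiv ℝ T y u) =
    fderiv ℝ a y v • (fderiv ℝ F y u + ⟪fderiv ℝ F y u, T y⟫ • T y) +
      a y • (⟪fderiv ℝ F y u, fderiv ℝ T y v⟫ • T y + ⟪fderiv ℝ F y u, T y⟫ • fderiv ℝ T y v) := by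
  have hN (u v : V) : fderiv ℝ (fderiv ℝ N) y u v =
      -(fderiv ℝ a y u • (fderiv ℝ F y v + ⟪fderiv ℝ F y v, T y⟫ • T y) +
      a y • (fderiv ℝ (fderiv ℝ F) y u v +
        ((⟪T y, fderiv ℝ (fderiv ℝ F) y u v⟫ + ⟪fderiv ℝ F y v, fderiv ℝ T y u⟫) • T y +
        ⟪fderiv ℝ F y v, T y⟫ • fderiv ℝ T y u))) := by
    have hd := hasFDerivAt_unique_of_eqOn h.isOpen (fun z hz ↦ h.fderiv_normal hz v) hy
      (h.hasFDerivAt_fderiv_normal hy v)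
      ((h.hasFDerivAt_curvature hy).neg.smul ((h.hasFDerivAt_fderiv hy v).add
        ((h.hasFDerivAt_inner_direction hy v).smul (h.hasFDerivAt_direction hy))))
    have hdu := DFunLike.congr_fun hd u
    simp only [ContinuousLinearMap.flip_apply, Pi.neg_apply, smul_add, neg_smul, add_apply,
      neg_apply, smul_apply, ContinuousLinearMap.smulRight_apply, ContinuousLinearMap.comp_apply,
      coe_innerSL_apply] at hdu
    rw [hdu]
    module
  have huv := hN u v
  rw [h.fderiv_fderiv_normal_comm hy, hN v u, h.fderiv_fderiv_comm hy] at huv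
  linear_combination (norm := module) huv

variable [FiniteDimensional ℝ V]

lemma fderiv_tangentPart_direction (h : PrincipalFrame Ω F N a T) (hy : y ∈ Ω) :
    fderiv ℝ F y (tangentPart F y (T y)) = T y :=
  h.fderiv_tangentPart hy (h.inner_direction_normal hy)

lemma inner_fderiv_sub_direction (h : PrincipalFrame Ω F N a T) (hy : y ∈ Ω) (u : V) :
    ⟪fderiv ℝ F y (u - ⟪fderiv ℝ F y u, T y⟫ • tangentPart F y (T y)), T y⟫ = 0 := by
  simp [inner_sub_left, inner_smul_left, h.fderiv_tangentPart_direction hy,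
    (h.hasIdealShape y hy).norm_eq_one]

/-- The logarithmic derivative of `a` in the direction of `T`. -/
def logDeriv (F : V → W) (a : V → ℝ) (T : V → W) (z : V) : ℝ :=
  (a z)⁻¹ * fderiv ℝ a z (tangentPart F z (T z))

lemma contDiffOn_logDeriv (h : PrincipalFrame Ω F N a T) : ContDiffOn ℝ ∞ (logDeriv F a T) Ω :=
  (h.contDiffOn_curvature.inv h.curvature_ne_zero).mul
    ((contDiffOn_fderiv h.isOpen h.contDiffOn_curvature).clm_apply
      (h.contDiffOn_tangentPart.clm_apply h.contDiffOn_direction))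

lemma hasFDerivAt_logDeriv (h : PrincipalFrame Ω F N a T) (hy : y ∈ Ω) :
    HasFDerivAt (logDeriv F a T) (fderiv ℝ (logDeriv F a T) y) y :=
  hasFDerivAt_of_contDiffOn h.isOpen h.contDiffOn_logDeriv hy

lemma fderiv_curvature_eq_zero (h : PrincipalFrame Ω F N a T) (hV : 3 ≤ finrank ℝ V) (hy : y ∈ Ω)
    {u : V} (hu : ⟪fderiv ℝ F y u, T y⟫ = 0) : fderiv ℝ a y u = 0 := by
  obtain ⟨v, hv0, hvT, hvu⟩ := exists_ne_zero_apply_eq_zero hV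
    (pullbackCovector F y (T y)) (pullbackCovector F y (fderiv ℝ F y u))
  simp only [pullbackCovector_apply] at hvT hvu
  have hcod := congrArg (fun w ↦ ⟪w, fderiv ℝ F y v⟫) (h.codazzi hy u v)
  simp only [hu, real_inner_comm (T y), hvT, zero_smul, add_zero, inner_add_left, inner_smul_left,
    hvu, mul_zero, RCLike.conj_to_real] at hcod
  exact (mul_eq_zero.1 hcod).resolve_right (h.inner_fderiv_self_pos hy hv0).ne'

lemma fderiv_curvature (h : PrincipalFrame Ω F N a T) (hV : 3 ≤ finrank ℝ V) (hy : y ∈ Ω) (u : V) :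
    fderiv ℝ a y u = a y * logDeriv F a T y * ⟪fderiv ℝ F y u, T y⟫ := by
  have hzero := h.fderiv_curvature_eq_zero hV hy (h.inner_fderiv_sub_direction hy u)
  rw [map_sub, map_smul, sub_eq_zero, smul_eq_mul] at hzero
  rw [hzero, logDeriv, mul_inv_cancel_left₀ (h.curvature_ne_zero y hy), mul_comm]

lemma inner_fderiv_direction_and_fderiv_direction (h : PrincipalFrame Ω F N a T)
    (hV : 3 ≤ finrank ℝ V) (hy : y ∈ Ω) {u : V} (hu : ⟪fderiv ℝ F y u, T y⟫ = 0) :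
    ⟪fderiv ℝ F y u, fderiv ℝ T y (tangentPart F y (T y))⟫ = 0 ∧
      fderiv ℝ T y u = logDeriv F a T y • fderiv ℝ F y u := by
  have ha := h.curvature_ne_zero y hy
  have hcod := h.codazzi hy u (tangentPart F y (T y))
  simp only [h.fderiv_curvature hV hy, hu, h.fderiv_tangentPart_direction hy,
    h.inner_direction_self hy, h.inner_direction_fderiv_direction hy, mul_zero, zero_smul, zero_add,
    add_zero, one_smul, mul_one] at hcod
  have hinner := congrArg (fun w ↦ ⟪T y, w⟫) hcod
  simp only [inner_add_right, inner_smul_right, h.inner_direction_fderiv_direction hy,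
    real_inner_comm (fderiv ℝ F y u), hu, h.inner_direction_self hy] at hinner
  have hzero : ⟪fderiv ℝ F y u, fderiv ℝ T y (tangentPart F y (T y))⟫ = 0 := by
    simpa [ha, real_inner_comm] using hinner.symm
  refine ⟨hzero, smul_right_injective _ ha ?_⟩
  rw [hzero, zero_smul, smul_zero, add_zero] at hcod
  simpa only [smul_smul] using hcod

lemma fderiv_direction_direction (h : PrincipalFrame Ω F N a T) (hV : 3 ≤ finrank ℝ V)
    (hy : y ∈ Ω) : fderiv ℝ T y (tangentPart F y (T y)) = (2 * a y) • N y := by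
  refine h.ext_inner hy (fun w ↦ ?_) ?_
  · have hzero := (h.inner_fderiv_direction_and_fderiv_direction hV hy
      (h.inner_fderiv_sub_direction hy w)).1
    rw [map_sub, map_smul, h.fderiv_tangentPart_direction hy, inner_sub_left, inner_smul_left,
      h.inner_direction_fderiv_direction hy, mul_zero, sub_zero] at hzero
    rw [hzero, inner_smul_right, h.inner_fderiv_normal hy, mul_zero]
  · rw [h.inner_normal_fderiv_direction hy, h.fderiv_tangentPart_direction hy,
      h.inner_direction_self hy, inner_smul_right, h.inner_normal_self hy]

lemma fderiv_direction (h : PrincipalFrame Ω F N a T) (hV : 3 ≤ finrank ℝ V) (hy : y ∈ Ω) (u : V) :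
    fderiv ℝ T y u = logDeriv F a T y •
      (fderiv ℝ F y u - ⟪fderiv ℝ F y u, T y⟫ • T y) + (2 * a y * ⟪fderiv ℝ F y u, T y⟫) • N y := by
  have hu := (h.inner_fderiv_direction_and_fderiv_direction hV hy
    (h.inner_fderiv_sub_direction hy u)).2
  rw [map_sub, map_smul, map_sub, map_smul, h.fderiv_direction_direction hV hy,
    h.fderiv_tangentPart_direction hy, sub_eq_iff_eq_add] at hu
  rw [hu]
  module

/-- The symmetry of the second derivative of `T`, expressed through the structure equations. -/
lemma codazzi_direction (h : PrincipalFrame Ω F N a T) (hV : 3 ≤ finrank ℝ V) (hy : y ∈ Ω)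
    (w u : V) :
    fderiv ℝ (logDeriv F a T) y w • (fderiv ℝ F y u - ⟪fderiv ℝ F y u, T y⟫ • T y)
      - (logDeriv F a T y * ⟪fderiv ℝ F y u, T y⟫) • fderiv ℝ T y w
      + (2 * fderiv ℝ a y w * ⟪fderiv ℝ F y u, T y⟫) • N y
      + (2 * a y * ⟪fderiv ℝ F y u, T y⟫) • fderiv ℝ N y w =
    fderiv ℝ (logDeriv F a T) y u • (fderiv ℝ F y w - ⟪fderiv ℝ F y w, T y⟫ • T y)
      - (logDeriv F a T y * ⟪fderiv ℝ F y w, T y⟫) • fderiv ℝ T y u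
      + (2 * fderiv ℝ a y u * ⟪fderiv ℝ F y w, T y⟫) • N y
      + (2 * a y * ⟪fderiv ℝ F y w, T y⟫) • fderiv ℝ N y u := by
  have hT (w u : V) : fderiv ℝ (fderiv ℝ T) y w u =
      fderiv ℝ (logDeriv F a T) y w • (fderiv ℝ F y u - ⟪fderiv ℝ F y u, T y⟫ • T y)
      + logDeriv F a T y • (fderiv ℝ (fderiv ℝ F) y w u
        - (⟪T y, fderiv ℝ (fderiv ℝ F) y w u⟫ + ⟪fderiv ℝ F y u, fderiv ℝ T y w⟫) • T y
        - ⟪fderiv ℝ F y u, T y⟫ • fderiv ℝ T y w)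
      + (2 * fderiv ℝ a y w * ⟪fderiv ℝ F y u, T y⟫ + 2 * a y *
        (⟪T y, fderiv ℝ (fderiv ℝ F) y w u⟫ + ⟪fderiv ℝ F y u, fderiv ℝ T y w⟫)) • N y
      + (2 * a y * ⟪fderiv ℝ F y u, T y⟫) • fderiv ℝ N y w := by
    have hd := hasFDerivAt_unique_of_eqOn h.isOpen (fun z hz ↦ h.fderiv_direction hV hz u) hy
      (hasFDerivAt_fderiv_apply h.isOpen h.contDiffOn_direction hy u)
      (((h.hasFDerivAt_logDeriv hy).smul ((h.hasFDerivAt_fderiv hy u).sub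
        ((h.hasFDerivAt_inner_direction hy u).smul (h.hasFDerivAt_direction hy)))).add
        ((((h.hasFDerivAt_curvature hy).const_mul 2).mul (h.hasFDerivAt_inner_direction hy u)).smul
          (h.hasFDerivAt_normal hy)))
    have hdw := DFunLike.congr_fun hd w
    simp only [ContinuousLinearMap.flip_apply, Pi.sub_apply, Pi.smul_apply', Pi.mul_apply,
      smul_add, add_apply, smul_apply, sub_apply, ContinuousLinearMap.smulRight_apply,
      ContinuousLinearMap.comp_apply, coe_innerSL_apply, smul_eq_mul] at hdw
    rw [hdw]
    module
  have hsymm : ⟪fderiv ℝ F y w, fderiv ℝ T y u⟫ = ⟪fderiv ℝ F y u, fderiv ℝ T y w⟫ := by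
    simp only [h.fderiv_direction hV hy, inner_add_right, inner_smul_right, inner_sub_right,
      h.inner_fderiv_normal hy, real_inner_comm (fderiv ℝ F y u) (fderiv ℝ F y w)]
    ring
  have hwu := hT w u
  rw [fderiv_fderiv_comm h.isOpen h.contDiffOn_direction hy, hT u w, h.fderiv_fderiv_comm hy,
    hsymm] at hwu
  linear_combination (norm := module) -hwu

lemma fderiv_logDeriv_eq_zero (h : PrincipalFrame Ω F N a T) (hV : 3 ≤ finrank ℝ V) (hy : y ∈ Ω)
    {u : V} (hu : ⟪fderiv ℝ F y u, T y⟫ = 0) : fderiv ℝ (logDeriv F a T) y u = 0 := by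
  obtain ⟨v, hv0, hvT, hvu⟩ := exists_ne_zero_apply_eq_zero hV
    (pullbackCovector F y (T y)) (pullbackCovector F y (fderiv ℝ F y u))
  simp only [pullbackCovector_apply] at hvT hvu
  have hcod := congrArg (fun w ↦ ⟪w, fderiv ℝ F y v⟫) (h.codazzi_direction hV hy u v)
  simp only [hu, real_inner_comm (T y), hvT, zero_smul, sub_zero, mul_zero, add_zero,
    inner_smul_left, hvu, RCLike.conj_to_real] at hcod
  exact (mul_eq_zero.1 hcod).resolve_right (h.inner_fderiv_self_pos hy hv0).ne'

lemma fderiv_logDeriv (h : PrincipalFrame Ω F N a T) (hV : 3 ≤ finrank ℝ V) (hy : y ∈ Ω) (u : V) :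
    fderiv ℝ (logDeriv F a T) y u =
      -(logDeriv F a T y ^ 2 + 2 * a y ^ 2) * ⟪fderiv ℝ F y u, T y⟫ := by
  have hzero := h.fderiv_logDeriv_eq_zero hV hy (h.inner_fderiv_sub_direction hy u)
  rw [map_sub, map_smul, sub_eq_zero, smul_eq_mul] at hzero
  rw [hzero, mul_comm]
  congr 1
  obtain ⟨v, hv0, hvT, -⟩ := exists_ne_zero_apply_eq_zero hV (pullbackCovector F y (T y)) 0
  rw [pullbackCovector_apply, real_inner_comm] at hvT
  have hcod := h.codazzi_direction hV hy (tangentPart F y (T y)) v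
  simp only [hvT, h.fderiv_tangentPart_direction hy, h.fderiv_normal hy, h.fderiv_curvature hV hy,
    h.fderiv_direction hV hy, h.inner_direction_self hy] at hcod
  have hsmul : (fderiv ℝ (logDeriv F a T) y (tangentPart F y (T y)) +
      (logDeriv F a T y ^ 2 + 2 * a y ^ 2)) • fderiv ℝ F y v = 0 := by
    linear_combination (norm := module) hcod
  exact eq_neg_of_add_eq_zero_left ((smul_eq_zero.1 hsmul).resolve_right (h.fderiv_ne_zero hy hv0))

/-- The structure equations `da = aκ θ`, `dκ = -(κ² + 2a²) θ` have a first integral. -/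
lemma hasFDerivAt_firstIntegral (h : PrincipalFrame Ω F N a T) (hV : 3 ≤ finrank ℝ V)
    (hy : y ∈ Ω) :
    HasFDerivAt (fun z ↦ a z ^ 4 + (a z * logDeriv F a T z) ^ 2) (0 : V →L[ℝ] ℝ) y := by
  have hd := ((h.hasFDerivAt_curvature hy).pow 4).add
    (((h.hasFDerivAt_curvature hy).mul (h.hasFDerivAt_logDeriv hy)).pow 2)
  refine hd.congr_fderiv ?_
  ext1 u
  simp only [Nat.add_one_sub_one, nsmul_eq_mul, Nat.cast_ofNat, Pi.mul_apply, pow_one, smul_add,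
    add_apply, smul_apply, h.fderiv_curvature hV hy, smul_eq_mul, h.fderiv_logDeriv hV hy,
    neg_add_rev, zero_apply]
  ring

end PrincipalFrame

end StructureEquations

section Flatness

variable {V W : Type*} [NormedAddCommGroup V] [NormedSpace ℝ V] [FiniteDimensional ℝ V]
  [NormedAddCommGroup W] [InnerProductSpace ℝ W] {Ω : Set V} {F N : V → W} {y : V}

namespace FramedHypersurface

lemma hasFDerivAt_principalCurvature (h : FramedHypersurface Ω F N) (hy : y ∈ Ω) :
    HasFDerivAt (principalCurvature F N) (fderiv ℝ (principalCurvature F N) y) y :=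
  hasFDerivAt_of_contDiffOn h.isOpen h.contDiffOn_principalCurvature hy

/-- Both `da` and `dN + a dF` are multiples of the principal direction; unlike the structure
equations this holds where `a` vanishes. -/
lemma fderiv_principalCurvature_smul_comm (h : FramedHypersurface Ω F N) (hid : IsIdealOn Ω F N)
    (hV : 3 ≤ finrank ℝ V) (hy : y ∈ Ω) (u v : V) :
    fderiv ℝ (principalCurvature F N) y v •
        (fderiv ℝ N y u + principalCurvature F N y • fderiv ℝ F y u) =
      fderiv ℝ (principalCurvature F N) y u •
        (fderiv ℝ N y v + principalCurvature F N y • fderiv ℝ F y v) := by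
  by_cases ha : principalCurvature F N y = 0
  · obtain ⟨T, hT⟩ := hid.exists_hasIdealShape h hy
    rw [ha] at hT ⊢
    simp only [hT.fderiv_normal_eq_zero, zero_smul, add_zero, smul_zero]
  · obtain ⟨Ω', -, hy', T, hT⟩ := h.exists_principalFrame hid hy ha
    rw [hT.fderiv_curvature hV hy', hT.fderiv_curvature hV hy', hT.fderiv_normal hy',
      hT.fderiv_normal hy']
    module

lemma fderiv_principalCurvature_eq_zero (h : FramedHypersurface Ω F N) (hid : IsIdealOn Ω F N)
    (hV : 3 ≤ finrank ℝ V) (hy : y ∈ Ω) (ha : principalCurvature F N y = 0) :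
    fderiv ℝ (principalCurvature F N) y = 0 := by
  have hN (u : V) : fderiv ℝ N y u = 0 := by
    obtain ⟨T, hT⟩ := hid.exists_hasIdealShape h hy
    rw [ha] at hT
    exact hT.fderiv_normal_eq_zero u
  by_contra hne
  obtain ⟨v, hv⟩ : ∃ v, fderiv ℝ (principalCurvature F N) y v ≠ 0 :=
    DFunLike.exists_ne hne
  obtain ⟨u, hu0, hu, -⟩ := exists_ne_zero_apply_eq_zero hV (fderiv ℝ (principalCurvature F N) y) 0
  have hdda := hasFDerivAt_fderiv_apply h.isOpen h.contDiffOn_principalCurvature hy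
  have hderiv (u : V) := (h.hasFDerivAt_fderiv_normal hy u).add
    ((h.hasFDerivAt_principalCurvature hy).smul (h.hasFDerivAt_fderiv hy u))
  have hsmul := hasFDerivAt_unique_of_eqOn h.isOpen
    (fun z hz ↦ h.fderiv_principalCurvature_smul_comm hid hV hz u v) hy
    ((hdda v).smul (hderiv u)) ((hdda u).smul (hderiv v))
  -- Differentiating the commutation relation at a zero of `a` gives `D²N(w, u) = -da(w) dF(u)` for
  -- `u` in the kernel of `da`, which contradicts the symmetry of `D²N` unless `da = 0`.
  have hD2N (w : V) : fderiv ℝ (fderiv ℝ N) y w u =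
      -fderiv ℝ (principalCurvature F N) y w • fderiv ℝ F y u := by
    have hw := DFunLike.congr_fun hsmul w
    simp only [ha, zero_smul, zero_add, smul_add, hN, add_zero, hu, zero_apply,
      ContinuousLinearMap.smulRight_zero, add_apply, smul_apply, ContinuousLinearMap.flip_apply,
      ContinuousLinearMap.smulRight_apply] at hw
    rw [← smul_add] at hw
    rw [neg_smul]
    exact eq_neg_of_add_eq_zero_left ((smul_eq_zero.1 hw).resolve_left hv)
  have hsymm := hasFDerivAt_unique_of_eqOn h.isOpen
    (fun z hz ↦ h.inner_fderiv_fderiv_normal_comm hz u v) hy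
    ((h.hasFDerivAt_fderiv hy u).inner ℝ (h.hasFDerivAt_fderiv_normal hy v))
    ((h.hasFDerivAt_fderiv hy v).inner ℝ (h.hasFDerivAt_fderiv_normal hy u))
  have hsymmu := DFunLike.congr_fun hsymm u
  simp only [hN, ContinuousLinearMap.comp_apply, ContinuousLinearMap.prod_apply,
    ContinuousLinearMap.flip_apply, fderivInnerCLM_apply, inner_zero_right, add_zero] at hsymmu
  rw [h.fderiv_fderiv_normal_comm hy, hD2N, hD2N, hu] at hsymmu
  simp only [inner_smul_right, neg_zero, zero_smul, inner_zero_right, mul_eq_zero] at hsymmu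
  exact hsymmu.elim (neg_ne_zero.2 hv) (h.inner_fderiv_self_pos hy hu0).ne'

end FramedHypersurface

/-- The first integral `a⁴ + |∇a|²` of an ideal hypersurface, in a form which makes sense across the
zeros of `a`. -/
def energy (F N : V → W) (y : V) : ℝ :=
  principalCurvature F N y ^ 4 + ‖(fderiv ℝ (principalCurvature F N) y).comp (tangentPart F y)‖ ^ 2

lemma PrincipalFrame.energy_eq {T : V → W} (h : PrincipalFrame Ω F N (principalCurvature F N) T)
    (hV : 3 ≤ finrank ℝ V) (hy : y ∈ Ω) :
    energy F N y = principalCurvature F N y ^ 4 +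
      (principalCurvature F N y * logDeriv F (principalCurvature F N) T y) ^ 2 := by
  have hgrad : (fderiv ℝ (principalCurvature F N) y).comp (tangentPart F y) =
      (principalCurvature F N y * logDeriv F (principalCurvature F N) T y) • innerSL ℝ (T y) := by
    ext1 w
    rw [ContinuousLinearMap.comp_apply, h.fderiv_curvature hV hy,
      ← h.fderiv_tangentPart_add_normal hy w]
    simp [inner_add_right, inner_smul_right, h.inner_direction_normal hy, real_inner_comm (T y),
      h.tangentPart_normal hy, h.tangentPart_fderiv hy]
  rw [energy, hgrad, norm_smul, innerSL_apply_norm, (h.hasIdealShape y hy).norm_eq_one, mul_one,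
    Real.norm_eq_abs, sq_abs]

namespace FramedHypersurface

lemma continuousOn_energy (h : FramedHypersurface Ω F N) : ContinuousOn (energy F N) Ω := by
  have ha := h.contDiffOn_principalCurvature
  have hgrad := (contDiffOn_fderiv h.isOpen ha).clm_comp h.contDiffOn_tangentPart
  exact (ha.continuousOn.pow 4).add (hgrad.continuousOn.norm.pow 2)

lemma energy_eq_zero_iff (h : FramedHypersurface Ω F N) (hid : IsIdealOn Ω F N)
    (hV : 3 ≤ finrank ℝ V) (hy : y ∈ Ω) : energy F N y = 0 ↔ principalCurvature F N y = 0 := by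
  refine ⟨fun hE ↦ ?_, fun ha ↦ by
    simp [energy, ha, h.fderiv_principalCurvature_eq_zero hid hV hy ha]⟩
  rw [energy, add_eq_zero_iff_of_nonneg (by positivity) (by positivity)] at hE
  exact pow_eq_zero_iff four_ne_zero |>.1 hE.1

lemma eventually_energy_eq (h : FramedHypersurface Ω F N) (hid : IsIdealOn Ω F N)
    (hV : 3 ≤ finrank ℝ V) (hy : y ∈ Ω) (ha : principalCurvature F N y ≠ 0) :
    ∀ᶠ z in 𝓝 y, energy F N z = energy F N y := by
  obtain ⟨Ω', -, hy', T, hT⟩ := h.exists_principalFrame hid hy ha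
  obtain ⟨r, hr, hball⟩ := Metric.isOpen_iff.1 hT.isOpen y hy'
  filter_upwards [Metric.ball_mem_nhds y hr] with z hz
  rw [hT.energy_eq hV (hball hz), hT.energy_eq hV hy']
  exact Metric.isOpen_ball.is_const_of_fderiv_eq_zero (𝕜 := ℝ) (convex_ball y r).isPreconnected
    (fun w hw ↦ (hT.hasFDerivAt_firstIntegral hV (hball hw)).differentiableAt
      |>.differentiableWithinAt)
    (fun w hw ↦ (hT.hasFDerivAt_firstIntegral hV (hball hw)).fderiv) hz (Metric.mem_ball_self hr)

theorem principalCurvature_eq_zero (h : FramedHypersurface Ω F N) (hid : IsIdealOn Ω F N)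
    (hV : 3 ≤ finrank ℝ V) (hΩ : IsPreconnected Ω) {p : V} (hp : p ∈ Ω)
    (ha : principalCurvature F N p = 0) (hy : y ∈ Ω) : principalCurvature F N y = 0 := by
  have hzero {z : V} (hz : z ∈ Ω) := h.energy_eq_zero_iff hid hV hz
  by_contra hne
  have hEy : energy F N y ≠ 0 := mt (hzero hy).1 hne
  have hlevel : IsOpen (Ω ∩ energy F N ⁻¹' {energy F N y}) := by
    rw [isOpen_iff_mem_nhds]
    rintro z ⟨hz, hzy⟩
    have haz : principalCurvature F N z ≠ 0 := mt (hzero hz).2 (hzy ▸ hEy)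
    filter_upwards [h.isOpen.mem_nhds hz, h.eventually_energy_eq hid hV hz haz] with w hw hwz
    exact ⟨hw, hwz.trans hzy⟩
  have hother := h.continuousOn_energy.isOpen_inter_preimage h.isOpen
    (isOpen_compl_singleton (x := energy F N y))
  obtain ⟨z, -, hz, hz'⟩ := hΩ _ _ hlevel hother
    (fun z hz ↦ (em (energy F N z = energy F N y)).imp (⟨hz, ·⟩) (⟨hz, ·⟩))
    ⟨y, hy, hy, rfl⟩ ⟨p, hp, hp, fun hpy ↦ hEy (hpy.symm.trans ((hzero hp).2 ha))⟩
  exact hz'.2 hz.2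

end FramedHypersurface

end Flatness

/-! ### Beez–Killing rigidity -/

section LocalRigidity

variable {V W : Type*} [NormedAddCommGroup V] [NormedSpace ℝ V]
  [NormedAddCommGroup W] [InnerProductSpace ℝ W] {Ω : Set V} {F N G N' : V → W} {y : V}

/-- For hypersurfaces `(F, N)` and `(G, N')` over the same domain, the linear map of the ambient
space which carries the frame `(dF, N)` at `y` to `(dG, N')`. -/
def frameTransfer (F N G N' : V → W) (y : V) : W →L[ℝ] W :=
  (fderiv ℝ G y).comp (tangentPart F y) +
    ContinuousLinearMap.smulRightL ℝ W W (innerSL ℝ (N y)) (N' y)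

lemma frameTransfer_apply (w : W) : frameTransfer F N G N' y w =
    fderiv ℝ G y (tangentPart F y w) + ⟪N y, w⟫ • N' y := by
  simp [frameTransfer]

lemma frameTransfer_normal (h : FramedHypersurface Ω F N) (hy : y ∈ Ω) :
    frameTransfer F N G N' y (N y) = N' y := by
  rw [frameTransfer_apply, h.tangentPart_normal hy, h.inner_normal_self hy, map_zero, one_smul,
    zero_add]

variable [FiniteDimensional ℝ V]

lemma frameTransfer_fderiv (h : FramedHypersurface Ω F N) (hy : y ∈ Ω) (u : V) :
    frameTransfer F N G N' y (fderiv ℝ F y u) = fderiv ℝ G y u := by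
  rw [frameTransfer_apply, h.tangentPart_fderiv hy, h.inner_normal_fderiv hy, zero_smul, add_zero]

set_option synthInstance.maxHeartbeats 200000 in
-- Instances on iterated spaces of continuous linear maps are slow to find.
lemma contDiffOn_frameTransfer (h : FramedHypersurface Ω F N) (h' : FramedHypersurface Ω G N') :
    ContDiffOn ℝ ∞ (frameTransfer F N G N') Ω := by
  have hcovector : ContDiffOn ℝ ∞ (fun y ↦ innerSL ℝ (N y)) Ω :=
    (innerSL ℝ (E := W)).contDiff.comp_contDiffOn h.contDiffOn_normal
  have hnormal := ((ContinuousLinearMap.smulRightL ℝ W W).contDiff.comp_contDiffOn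
    hcovector).clm_apply h'.contDiffOn_normal
  exact ((contDiffOn_fderiv h.isOpen h'.contDiffOn).clm_comp h.contDiffOn_tangentPart).add hnormal

lemma inner_frameTransfer (h : FramedHypersurface Ω F N) (h' : FramedHypersurface Ω G N')
    (hg : Set.EqOn (firstForm F) (firstForm G) Ω) (hy : y ∈ Ω) (w z : W) :
    ⟪frameTransfer F N G N' y w, frameTransfer F N G N' y z⟫ = ⟪w, z⟫ := by
  have hG (u v : V) : ⟪fderiv ℝ G y u, fderiv ℝ G y v⟫ = ⟪fderiv ℝ F y u, fderiv ℝ F y v⟫ := by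
    rw [← firstForm_apply, ← hg hy, firstForm_apply]
  conv_rhs => rw [← h.fderiv_tangentPart_add_normal hy w, ← h.fderiv_tangentPart_add_normal hy z]
  simp only [frameTransfer_apply, inner_add_left, inner_add_right, inner_smul_left,
    inner_smul_right, hG, h.inner_fderiv_normal hy, h.inner_normal_fderiv hy,
    h'.inner_fderiv_normal hy, h'.inner_normal_fderiv hy, h.inner_normal_self hy,
    h'.inner_normal_self hy, RCLike.conj_to_real]
  simp only [real_inner_comm (N y)]

section SecondForm

variable (h : FramedHypersurface Ω F N) (h' : FramedHypersurface Ω G N')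
  (hg : Set.EqOn (firstForm F) (firstForm G) Ω)
  (hII : Set.EqOn (normalForm F N) (normalForm G N') Ω)

include h h' hg hII

lemma frameTransfer_fderiv_fderiv (hy : y ∈ Ω) (u v : V) :
    frameTransfer F N G N' y (fderiv ℝ (fderiv ℝ F) y u v) = fderiv ℝ (fderiv ℝ G) y u v := by
  have hsecond : frameTransfer F N G N' y (secondForm F y u v) = secondForm G y u v := by
    rw [h.secondForm_eq hy, map_smul, frameTransfer_normal h hy, hII hy, h'.secondForm_eq hy]
  rw [← fderiv_connectionForm_add_secondForm, map_add, frameTransfer_fderiv h hy, hsecond,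
    h.toIsImmersionOn.connectionForm_congr h'.toIsImmersionOn hg hy,
    fderiv_connectionForm_add_secondForm]

lemma frameTransfer_fderiv_normal (hy : y ∈ Ω) (u : V) :
    frameTransfer F N G N' y (fderiv ℝ N y u) = fderiv ℝ N' y u := by
  refine h'.ext_inner hy (fun v ↦ ?_) ?_
  · have hII : normalForm F N y u v = normalForm G N' y u v := by rw [hII hy]
    rw [normalForm_apply, normalForm_apply, h.weingarten hy,
      h'.weingarten hy] at hII
    rw [← frameTransfer_fderiv (G := G) (N' := N') h hy, inner_frameTransfer h h' hg hy]
    exact neg_injective (by rw [hII, frameTransfer_fderiv h hy])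
  · rw [h'.inner_normal_fderiv_normal hy, ← frameTransfer_normal (G := G) (N' := N') h hy,
      inner_frameTransfer h h' hg hy, h.inner_normal_fderiv_normal hy]

lemma fderiv_frameTransfer (hy : y ∈ Ω) : fderiv ℝ (frameTransfer F N G N') y = 0 := by
  have hO := hasFDerivAt_of_contDiffOn h.isOpen (contDiffOn_frameTransfer h h') hy
  ext1 w
  have htangent (u : V) : fderiv ℝ (frameTransfer F N G N') y w (fderiv ℝ F y u) = 0 := by
    have hd := hasFDerivAt_unique_of_eqOn h.isOpen
      (fun z hz ↦ frameTransfer_fderiv (G := G) (N' := N') h hz u) hy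
      (hO.clm_apply (h.hasFDerivAt_fderiv hy u)) (h'.hasFDerivAt_fderiv hy u)
    simpa [frameTransfer_fderiv_fderiv h h' hg hII hy] using DFunLike.congr_fun hd w
  have hnormal : fderiv ℝ (frameTransfer F N G N') y w (N y) = 0 := by
    have hd := hasFDerivAt_unique_of_eqOn h.isOpen
      (fun z hz ↦ frameTransfer_normal (G := G) (N' := N') h hz) hy
      (hO.clm_apply (h.hasFDerivAt_normal hy)) (h'.hasFDerivAt_normal hy)
    simpa [frameTransfer_fderiv_normal h h' hg hII hy] using DFunLike.congr_fun hd w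
  ext1 z
  rw [← h.fderiv_tangentPart_add_normal hy z, map_add, map_smul, htangent, hnormal]
  simp

theorem exists_isometry_of_forms_eq [FiniteDimensional ℝ W] (hΩ : IsPreconnected Ω) :
    ∃ (O : W ≃ₗᵢ[ℝ] W) (c : W), ∀ y ∈ Ω, G y = O (F y) + c := by
  obtain rfl | ⟨p, hp⟩ := Ω.eq_empty_or_nonempty
  · exact ⟨.refl ℝ W, 0, fun y hy ↦ hy.elim⟩
  set A := frameTransfer F N G N' p
  have hconst {y : V} (hy : y ∈ Ω) : frameTransfer F N G N' y = A :=
    h.isOpen.is_const_of_fderiv_eq_zero (𝕜 := ℝ) hΩ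
      ((contDiffOn_frameTransfer h h').differentiableOn (by simp))
      (fun z hz ↦ fderiv_frameTransfer h h' hg hII hz) hy hp
  let O : W ≃ₗᵢ[ℝ] W :=
    (A.toLinearMap.isometryOfInner (inner_frameTransfer h h' hg hp)).toLinearIsometryEquiv rfl
  have hd {y : V} (hy : y ∈ Ω) : HasFDerivAt (fun z ↦ G z - A (F z)) (0 : V →L[ℝ] W) y := by
    refine ((h'.hasFDerivAt hy).sub (A.hasFDerivAt.comp y (h.hasFDerivAt hy))).congr_fderiv ?_
    ext1 u
    simp [← hconst hy, frameTransfer_fderiv h hy]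
  refine ⟨O, G p - A (F p), fun y hy ↦ ?_⟩
  have hsub := h.isOpen.is_const_of_fderiv_eq_zero (𝕜 := ℝ) hΩ
    (fun z hz ↦ (hd hz).differentiableAt.differentiableWithinAt) (fun z hz ↦ (hd hz).fderiv) hy hp
  rw [← hsub]
  exact (add_sub_cancel _ _).symm

end SecondForm

end LocalRigidity

section Gauss

variable {V W : Type*} [NormedAddCommGroup V] [NormedSpace ℝ V] [NormedAddCommGroup W]
  [InnerProductSpace ℝ W] {Ω : Set V} {F : V → W} {y : V}

/-- The curvature `R(u, v) w` of the connection induced by an immersion `F`, on constant vector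
fields. -/
def curvatureForm (F : V → W) (y u v w : V) : V :=
  fderiv ℝ (fun z ↦ connectionForm F z v w) y u - fderiv ℝ (fun z ↦ connectionForm F z u w) y v +
    (connectionForm F y u (connectionForm F y v w) - connectionForm F y v (connectionForm F y u w))

namespace IsImmersionOn

variable [FiniteDimensional ℝ V]

lemma contDiffOn_connectionForm (h : IsImmersionOn Ω F) (u v : V) :
    ContDiffOn ℝ ∞ (fun z ↦ connectionForm F z u v) Ω :=
  h.contDiffOn_tangentPart.clm_apply <|
    ((contDiffOn_fderiv h.isOpen (contDiffOn_fderiv h.isOpen h.contDiffOn)).clm_apply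
      contDiffOn_const).clm_apply contDiffOn_const

lemma hasFDerivAt_connectionForm (h : IsImmersionOn Ω F) (hy : y ∈ Ω) (u v : V) :
    HasFDerivAt (fun z ↦ connectionForm F z u v)
      (fderiv ℝ (fun z ↦ connectionForm F z u v) y) y :=
  hasFDerivAt_of_contDiffOn h.isOpen (h.contDiffOn_connectionForm u v) hy

lemma curvatureForm_congr {W' : Type*} [NormedAddCommGroup W'] [InnerProductSpace ℝ W']
    {G : V → W'} (h : IsImmersionOn Ω F) (h' : IsImmersionOn Ω G)
    (hg : Set.EqOn (firstForm F) (firstForm G) Ω) (hy : y ∈ Ω) (u v w : V) :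
    curvatureForm F y u v w = curvatureForm G y u v w := by
  have hfderiv (u v : V) : fderiv ℝ (fun z ↦ connectionForm F z u v) y =
      fderiv ℝ (fun z ↦ connectionForm G z u v) y :=
    hasFDerivAt_unique_of_eqOn h.isOpen (fun z hz ↦ h.connectionForm_congr h' hg hz u v) hy
      (h.hasFDerivAt_connectionForm hy u v) (h'.hasFDerivAt_connectionForm hy u v)
  simp only [curvatureForm, hfderiv, h.connectionForm_congr h' hg hy]

lemma inner_secondForm_secondForm (h : IsImmersionOn Ω F) (hy : y ∈ Ω) (u v w z : V) :
    ⟪secondForm F y u v, fderiv ℝ (fderiv ℝ F) y w z⟫ =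
      ⟪secondForm F y u v, secondForm F y w z⟫ := by
  rw [← fderiv_connectionForm_add_secondForm F y w z, inner_add_right,
    h.inner_secondForm_fderiv hy, zero_add]

lemma inner_fderiv_fderiv_fderiv (h : IsImmersionOn Ω F) (hy : y ∈ Ω) (u v w z : V) :
    ⟪fderiv ℝ (fderiv ℝ (fderiv ℝ F)) y u v w, fderiv ℝ F y z⟫ =
      ⟪fderiv ℝ F y (fderiv ℝ (fun x ↦ connectionForm F x v w) y u +
          connectionForm F y u (connectionForm F y v w)), fderiv ℝ F y z⟫ -
        ⟪secondForm F y v w, secondForm F y u z⟫ := by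
  have hII : HasFDerivAt (fun x ↦ secondForm F x v w) _ y :=
    ((hasFDerivAt_fderiv_apply h.isOpen (contDiffOn_fderiv h.isOpen h.contDiffOn) hy v).clm_apply
      (hasFDerivAt_const w y)).sub
      ((hasFDerivAt_of_contDiffOn h.isOpen (contDiffOn_fderiv h.isOpen h.contDiffOn) hy).clm_apply
        (h.hasFDerivAt_connectionForm hy v w))
  have hnormal := inner_add_inner_eq_zero_of_inner_const h.isOpen hy hII
    (h.hasFDerivAt_fderiv hy z) (fun x hx ↦ h.inner_secondForm_fderiv hx v w z) u
  have htangent : ⟪fderiv ℝ (fderiv ℝ F) y u (connectionForm F y v w), fderiv ℝ F y z⟫ =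
      ⟪fderiv ℝ F y (connectionForm F y u (connectionForm F y v w)), fderiv ℝ F y z⟫ :=
    (h.inner_fderiv_tangentPart hy _ z).symm
  simp only [h.inner_secondForm_secondForm hy, ContinuousLinearMap.comp_zero, zero_add, sub_apply,
    add_apply, ContinuousLinearMap.flip_apply, ContinuousLinearMap.comp_apply, inner_sub_left,
    inner_add_left, htangent, map_add] at hnormal ⊢
  linarith

lemma gauss (h : IsImmersionOn Ω F) (hy : y ∈ Ω) (u v w z : V) :
    ⟪fderiv ℝ F y (curvatureForm F y u v w), fderiv ℝ F y z⟫ =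
      ⟪secondForm F y v w, secondForm F y u z⟫ - ⟪secondForm F y u w, secondForm F y v z⟫ := by
  have huv := h.inner_fderiv_fderiv_fderiv hy u v w z
  have hvu := h.inner_fderiv_fderiv_fderiv hy v u w z
  rw [Casorati.fderiv_fderiv_comm h.isOpen (contDiffOn_fderiv h.isOpen h.contDiffOn) hy v u] at hvu
  simp only [curvatureForm, map_add, map_sub, inner_add_left, inner_sub_left] at huv hvu ⊢
  linarith

lemma gauss_congr {W' : Type*} [NormedAddCommGroup W'] [InnerProductSpace ℝ W']
    {G : V → W'} (h : IsImmersionOn Ω F) (h' : IsImmersionOn Ω G)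
    (hg : Set.EqOn (firstForm F) (firstForm G) Ω) (hy : y ∈ Ω) (u v w z : V) :
    ⟪secondForm F y v w, secondForm F y u z⟫ - ⟪secondForm F y u w, secondForm F y v z⟫ =
      ⟪secondForm G y v w, secondForm G y u z⟫ - ⟪secondForm G y u w, secondForm G y v z⟫ := by
  rw [← h.gauss hy, ← h'.gauss hy, h.curvatureForm_congr h' hg hy, ← firstForm_apply,
    ← firstForm_apply, hg hy]

end IsImmersionOn

end Gauss

section BeezKilling

variable {K V V' : Type*} [Field K] [AddCommGroup V] [Module K V] [AddCommGroup V'] [Module K V']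

lemma linearIndependent_pair_of_ne {ι : Type*} {x : ι → V} (hx : LinearIndependent K x) {i j : ι}
    (hij : i ≠ j) : LinearIndependent K ![x i, x j] := by
  have hinj : Function.Injective ![i, j] := by
    simpa [Function.Injective, Fin.forall_fin_two] using ⟨hij, hij.symm⟩
  convert hx.comp ![i, j] hinj using 1
  ext k : 1
  fin_cases k <;> rfl

lemma exists_minor_ne_zero {φ ψ : V' →ₗ[K] K} (hind : LinearIndependent K ![φ, ψ]) :
    ∃ w z, φ z * ψ w - φ w * ψ z ≠ 0 := by
  by_contra! h
  have hφ (w : V') : φ w = 0 := by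
    have hzero : ψ w • φ + -φ w • ψ = 0 := by
      ext z
      simpa [mul_comm, ← sub_eq_add_neg] using h w z
    simpa using (LinearIndependent.pair_iff.1 hind _ _ hzero).2
  exact hind.ne_zero 0 (LinearMap.ext hφ)

lemma mem_span_pair_of_minors_eq {φ ψ φ' ψ' : V' →ₗ[K] K} (hind : LinearIndependent K ![φ, ψ])
    (h : ∀ w z, φ z * ψ w - φ w * ψ z = φ' z * ψ' w - φ' w * ψ' z) :
    φ' ∈ Submodule.span K {φ, ψ} := by
  obtain ⟨w, z, hwz⟩ := exists_minor_ne_zero hind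
  rw [← Submodule.smul_mem_iff _ hwz, Submodule.mem_span_pair]
  refine ⟨φ' z * ψ w - φ' w * ψ z, φ z * φ' w - φ w * φ' z, ?_⟩
  -- The coefficients come from expanding `φ' ∧ φ ∧ ψ = φ' ∧ φ' ∧ ψ' = 0` at `(x, z, w)`.
  ext x
  simp only [LinearMap.add_apply, LinearMap.smul_apply, smul_eq_mul]
  linear_combination -φ' x * h w z - φ' z * h x w - φ' w * h z x

variable {b b' : V →ₗ[K] V' →ₗ[K] K}

lemma exists_eq_smul_of_minors_eq (hb : Function.Injective b) (hV : 3 ≤ finrank K V)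
    (h : ∀ u v w z, b u z * b v w - b u w * b v z = b' u z * b' v w - b' u w * b' v z) (u : V) :
    ∃ c : K, b' u = c • b u := by
  obtain rfl | hu := eq_or_ne u 0
  · simp
  obtain ⟨v, huv⟩ := exists_linearIndependent_pair_of_one_lt_finrank (R := K) (by omega) hu
  obtain ⟨w, hwuv⟩ := exists_linearIndependent_cons_of_lt_finrank huv hV
  have hind := hwuv.map_injOn b hb.injOn
  have huv' : LinearIndependent K ![b u, b v] :=
    linearIndependent_pair_of_ne hind (i := 1) (j := 2) (by decide)
  have huw' : LinearIndependent K ![b u, b w] :=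
    linearIndependent_pair_of_ne hind (i := 1) (j := 0) (by decide)
  obtain ⟨s, t, hst⟩ := Submodule.mem_span_pair.1 (mem_span_pair_of_minors_eq huv' (h u v))
  obtain ⟨s', t', hst'⟩ := Submodule.mem_span_pair.1 (mem_span_pair_of_minors_eq huw' (h u w))
  have ht' : t' = 0 := by
    have hzero : t' • b w + (s' - s) • b u + -(t • b v) = 0 := by
      rw [← sub_eq_zero.2 (hst'.trans hst.symm)]
      module
    refine Fintype.linearIndependent_iff.1 hind ![t', s' - s, -t] ?_ 0
    simpa [Fin.sum_univ_three] using hzero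
  exact ⟨s', by rw [← hst', ht', zero_smul, add_zero]⟩

lemma mul_eq_one_of_minors_eq {φ ψ : V' →ₗ[K] K} (hind : LinearIndependent K ![φ, ψ]) {c d : K}
    (h : ∀ w z, φ z * ψ w - φ w * ψ z = (c • φ) z * (d • ψ) w - (c • φ) w * (d • ψ) z) :
    c * d = 1 := by
  obtain ⟨w, z, hwz⟩ := exists_minor_ne_zero hind
  refine mul_right_cancel₀ hwz ?_
  simp only [LinearMap.smul_apply, smul_eq_mul] at h
  linear_combination -h w z

lemma eq_or_eq_neg_of_minors_eq (hb : Function.Injective b) (hV : 3 ≤ finrank K V)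
    (h : ∀ u v w z, b u z * b v w - b u w * b v z = b' u z * b' v w - b' u w * b' v z) :
    b' = b ∨ b' = -b := by
  choose c hc using exists_eq_smul_of_minors_eq hb hV h
  have hmul {u v : V} (huv : LinearIndependent K ![u, v]) : c u * c v = 1 := by
    have huv' : LinearIndependent K ![b u, b v] :=
      linearIndependent_pair_of_ne (huv.map_injOn b hb.injOn) (i := 0) (j := 1) (by decide)
    exact mul_eq_one_of_minors_eq huv' fun w z ↦ by rw [← hc, ← hc, h]
  have heq {u v : V} (huv : LinearIndependent K ![u, v]) : c v = c u := by
    obtain ⟨w, hwuv⟩ := exists_linearIndependent_cons_of_lt_finrank huv hV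
    have hwu : c w * c u = 1 := hmul <|
      linearIndependent_pair_of_ne hwuv (i := 0) (j := 1) (by decide)
    have hwv : c w * c v = 1 := hmul <|
      linearIndependent_pair_of_ne hwuv (i := 0) (j := 2) (by decide)
    exact mul_left_cancel₀ (left_ne_zero_of_mul_eq_one hwu) (hwv.trans hwu.symm)
  have : Nontrivial V := nontrivial_of_finrank_pos (R := K) (by omega)
  obtain ⟨u, hu⟩ := exists_ne (0 : V)
  have hb' : b' = c u • b := by
    ext1 v
    by_cases huv : LinearIndependent K ![u, v]
    · rw [hc, heq huv, LinearMap.smul_apply]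
    · obtain ⟨s, rfl⟩ : ∃ s : K, s • u = v := by
        simpa [LinearIndependent.pair_iff' hu] using huv
      rw [map_smul, map_smul, hc, LinearMap.smul_apply]
  obtain ⟨v, huv⟩ := exists_linearIndependent_pair_of_one_lt_finrank (R := K) (by omega) hu
  obtain hcu | hcu := mul_self_eq_one_iff.1 (heq huv ▸ hmul huv)
  · exact .inl (by rw [hb', hcu, one_smul])
  · exact .inr (by ext; simp [hb', hcu])

end BeezKilling

/-! ### Equality in the Casorati inequality -/

section Algebra

variable {V W ι κ : Type*} [NormedAddCommGroup V] [InnerProductSpace ℝ V] [Fintype ι] [Fintype κ]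

lemma sum_apply_self_eq {X : Type*} [AddCommGroup X] [Module ℝ X] (C : V →ₗ[ℝ] V →ₗ[ℝ] X)
    (e : OrthonormalBasis ι ℝ V) (e' : OrthonormalBasis κ ℝ V) :
    ∑ i, C (e i) (e i) = ∑ i, C (e' i) (e' i) := by
  have : FiniteDimensional ℝ V := e.toBasis.finiteDimensional_of_finite
  have heq := (InnerProductSpace.canonicalCovariantTensor_eq_sum V e).symm.trans
    (InnerProductSpace.canonicalCovariantTensor_eq_sum V e')
  simpa using congrArg (TensorProduct.lift C) heq

variable [NormedAddCommGroup W] [InnerProductSpace ℝ W]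

lemma sum_norm_sq_eq (A : V →ₗ[ℝ] W) (e : OrthonormalBasis ι ℝ V) (e' : OrthonormalBasis κ ℝ V) :
    ∑ i, ‖A (e i)‖ ^ 2 = ∑ i, ‖A (e' i)‖ ^ 2 := by
  simpa using sum_apply_self_eq ((innerₗ W).compl₁₂ A A) e e'

/-- The sum `∑ ‖B(eᵢ, eⱼ)‖²` for a vector-valued bilinear form `B`; up to normalization, the
Casorati curvature of the span of an orthonormal family `e`. -/
def casoratiSum (B : V →ₗ[ℝ] V →ₗ[ℝ] W) (e : ι → V) : ℝ := ∑ i, ∑ j, ‖B (e i) (e j)‖ ^ 2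

lemma casoratiSum_eq (B : V →ₗ[ℝ] V →ₗ[ℝ] W) (e : OrthonormalBasis ι ℝ V)
    (e' : OrthonormalBasis κ ℝ V) : casoratiSum B e = casoratiSum B e' := by
  simp only [casoratiSum, sum_norm_sq_eq _ e e']
  rw [Finset.sum_comm]
  simp only [← LinearMap.flip_apply B, sum_norm_sq_eq _ e e']
  exact Finset.sum_comm

lemma exists_orthonormalBasis_option {L : Submodule ℝ V} (c : OrthonormalBasis κ ℝ L)
    (hdim : Fintype.card κ + 1 = finrank ℝ V) {t : V} (ht : ‖t‖ = 1) (htL : t ∈ Lᗮ) :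
    ∃ e : OrthonormalBasis (Option κ) ℝ V, e none = t ∧ ∀ i, e (some i) = c i := by
  classical
  have : FiniteDimensional ℝ V := .of_finrank_pos (by omega)
  let v : Option κ → V := fun o ↦ o.elim t fun i ↦ c i
  have hv : Orthonormal ℝ v := by
    have hct (i : κ) : ⟪(c i : V), t⟫ = 0 := htL _ (c i).2
    have hc := orthonormal_iff_ite.1 c.orthonormal
    simp only [Submodule.coe_inner] at hc
    rw [orthonormal_iff_ite]
    rintro (_ | i) (_ | j)
    · simp [v, ht]
    · rw [real_inner_comm]
      simp [v, hct]
    · simp [v, hct]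
    · simp [v, hc]
  have hspan := (hv.linearIndependent.span_eq_top_of_card_eq_finrank' (by simpa using hdim)).ge
  exact ⟨.mk hv hspan, by simp [v], by simp [v]⟩

variable {B : V →ₗ[ℝ] V →ₗ[ℝ] W}

lemma casoratiSum_option (hB : ∀ u v, B u v = B v u) (e : Option κ → V) :
    casoratiSum B e = casoratiSum B (fun i ↦ e (some i)) +
      2 * ∑ i, ‖B (e none) (e (some i))‖ ^ 2 + ‖B (e none) (e none)‖ ^ 2 := by
  simp only [casoratiSum, Fintype.sum_option, Finset.sum_add_distrib, hB _ (e none)]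
  ring

lemma casoratiSum_hyperplane (hB : ∀ u v, B u v = B v u) {L : Submodule ℝ V}
    (c : OrthonormalBasis κ ℝ L) (e : OrthonormalBasis ι ℝ V)
    (hdim : Fintype.card κ + 1 = finrank ℝ V) {t : V} (ht : ‖t‖ = 1) (htL : t ∈ Lᗮ) :
    casoratiSum B (fun i ↦ (c i : V)) =
      casoratiSum B e - 2 * ∑ i, ‖B t (e i)‖ ^ 2 + ‖B t t‖ ^ 2 := by
  obtain ⟨e', rfl, hc⟩ := exists_orthonormalBasis_option c hdim ht htL
  rw [casoratiSum_eq B e e', sum_norm_sq_eq _ e e', casoratiSum_option hB, Fintype.sum_option]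
  simp only [hc]
  ring

/-- The Casorati curvature of a subspace `L` with respect to a vector-valued bilinear form. -/
def casoratiOn (B : V →ₗ[ℝ] V →ₗ[ℝ] W) (L : Submodule ℝ V) [FiniteDimensional ℝ L] : ℝ :=
  (1 / (finrank ℝ L : ℝ)) * casoratiSum B fun i ↦ (stdOrthonormalBasis ℝ L i : V)

lemma sum_norm_sub_ite_sq [DecidableEq κ] {v : κ → V} {a : W}
    (ha : ∑ i, B (v i) (v i) = (Fintype.card κ : ℝ) • a) :
    ∑ i, ∑ j, ‖B (v i) (v j) - if i = j then a else 0‖ ^ 2 =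
      casoratiSum B v - Fintype.card κ * ‖a‖ ^ 2 := by
  have htrace : ∑ i, ⟪B (v i) (v i), a⟫ = Fintype.card κ * ‖a‖ ^ 2 := by
    rw [← sum_inner, ha, inner_smul_left, real_inner_self_eq_norm_sq, conj_trivial]
  have hsq (i j : κ) : ‖B (v i) (v j) - if i = j then a else 0‖ ^ 2 =
      ‖B (v i) (v j)‖ ^ 2 + if i = j then ‖a‖ ^ 2 - 2 * ⟪B (v i) (v j), a⟫ else 0 := by
    split_ifs
    · rw [norm_sub_sq_real]
      ring
    · simp
  simp only [hsq, Finset.sum_add_distrib, Finset.sum_ite_eq, Finset.mem_univ, if_true,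
    Finset.sum_sub_distrib, ← Finset.mul_sum, htrace, casoratiSum, Finset.sum_const,
    Finset.card_univ, nsmul_eq_mul]
  ring

/-- The Casorati inequality is the nonnegativity of the right-hand side, and equality means that
each square vanishes. -/
lemma casorati_defect [DecidableEq κ] (hB : ∀ u v, B u v = B v u) {v : Option κ → V} {a : W}
    (ha : ∑ i, B (v (some i)) (v (some i)) = (Fintype.card κ : ℝ) • a) :
    (Fintype.card κ + 2) * (casoratiSum B v + casoratiSum B fun i ↦ v (some i)) -
        2 * ‖∑ i, B (v i) (v i)‖ ^ 2 =
      2 * (Fintype.card κ + 2) *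
          (∑ i, ∑ j, ‖B (v (some i)) (v (some j)) - if i = j then a else 0‖ ^ 2 +
            ∑ i, ‖B (v none) (v (some i))‖ ^ 2) +
        Fintype.card κ * ‖B (v none) (v none) - (2 : ℝ) • a‖ ^ 2 := by
  rw [sum_norm_sub_ite_sq ha, casoratiSum_option hB, Fintype.sum_option, ha, norm_add_sq_real,
    norm_sub_sq_real]
  simp only [norm_smul, inner_smul_right, mul_pow, Real.norm_eq_abs, sq_abs]
  ring

lemma exists_eq_smul_of_casorati_ideal [Nonempty κ] (hB : ∀ u v, B u v = B v u)
    (e : OrthonormalBasis (Option κ) ℝ V)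
    (h : (Fintype.card κ + 2) * (casoratiSum B e + casoratiSum B fun i ↦ e (some i)) =
      2 * ‖∑ i, B (e i) (e i)‖ ^ 2) :
    ∃ η : W, ∀ u v, B u v = (⟪u, v⟫ + ⟪u, e none⟫ * ⟪v, e none⟫) • η := by
  classical
  have hκ : (0 : ℝ) < Fintype.card κ := by exact_mod_cast Fintype.card_pos
  let a := (Fintype.card κ : ℝ)⁻¹ • ∑ i, B (e (some i)) (e (some i))
  have hdefect := casorati_defect hB (v := e) (a := a) (smul_inv_smul₀ hκ.ne' _).symm
  rw [h, sub_self, eq_comm, add_eq_zero_iff_of_nonneg (by positivity) (by positivity),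
    mul_eq_zero_iff_left (by positivity), mul_eq_zero_iff_left hκ.ne', sq_eq_zero_iff, norm_eq_zero,
    add_eq_zero_iff_of_nonneg (by positivity) (by positivity),
    Fintype.sum_eq_zero_iff_of_nonneg fun i ↦ by positivity,
    Fintype.sum_eq_zero_iff_of_nonneg fun i ↦ by positivity] at hdefect
  obtain ⟨⟨hss, hns⟩, hnn⟩ := hdefect
  have hsome (i j : κ) : B (e (some i)) (e (some j)) = if i = j then a else 0 := by
    have hi := (Fintype.sum_eq_zero_iff_of_nonneg fun j ↦ by positivity).1 (congrFun hss i)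
    simpa [sub_eq_zero] using congrFun hi j
  have hnone (i : κ) : B (e none) (e (some i)) = 0 := by simpa using congrFun hns i
  let C : V →ₗ[ℝ] V →ₗ[ℝ] ℝ :=
    innerₗ V + (LinearMap.mul ℝ ℝ).compl₁₂ (innerₗ V (e none)) (innerₗ V (e none))
  have hC : B = C.compr₂ (LinearMap.toSpanSingleton ℝ W a) := by
    refine LinearMap.ext_basis e.toBasis e.toBasis ?_
    rintro (_ | i) (_ | j)
    · simp [C, sub_eq_zero.1 hnn, one_add_one_eq_two]
    · simp [C, hnone, e.inner_eq_ite]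
    · simp [C, hB _ (e none), hnone, e.inner_eq_ite]
    · simp [C, hsome, e.inner_eq_ite]
  exact ⟨a, fun u v ↦ by simp [hC, C, real_inner_comm]⟩

variable [FiniteDimensional ℝ V]

lemma exists_unit_mem_orthogonal {L : Submodule ℝ V} (hL : finrank ℝ L + 1 = finrank ℝ V) :
    ∃ t ∈ Lᗮ, ‖t‖ = 1 := by
  have hdim := L.finrank_add_finrank_orthogonal
  have : Nontrivial Lᗮ := nontrivial_of_finrank_pos (R := ℝ) (by omega)
  obtain ⟨t, ht⟩ := exists_norm_eq Lᗮ zero_le_one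
  exact ⟨t, t.2, ht⟩

lemma continuous_apply_self (B : V →ₗ[ℝ] V →ₗ[ℝ] W) : Continuous fun t ↦ B t t := by
  simpa using B.toContinuousBilinearMap.continuous.clm_apply continuous_id

lemma exists_sInf_casoratiOn_eq (hB : ∀ u v, B u v = B v u) (hV : 0 < finrank ℝ V) :
    ∃ L : Submodule ℝ V, finrank ℝ L + 1 = finrank ℝ V ∧
      sInf {c : ℝ | ∃ L : Submodule ℝ V, finrank ℝ L + 1 = finrank ℝ V ∧ c = casoratiOn B L} =
        casoratiOn B L := by
  let e := stdOrthonormalBasis ℝ V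
  let q : V → ℝ := fun t ↦ casoratiSum B e - 2 * ∑ i, ‖B t (e i)‖ ^ 2 + ‖B t t‖ ^ 2
  have hq : Continuous q := by
    have hBt := continuous_apply_self B
    have hBe (i) : Continuous fun t ↦ B t (e i) :=
      (B.flip (e i)).continuous_of_finiteDimensional
    exact (continuous_const.sub (.const_mul (by fun_prop) 2)).add (hBt.norm.pow 2)
  have hcasorati {L : Submodule ℝ V} (hL : finrank ℝ L + 1 = finrank ℝ V) {t : V} (ht : ‖t‖ = 1)
      (htL : t ∈ Lᗮ) : casoratiOn B L = 1 / ((finrank ℝ V : ℝ) - 1) * q t := by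
    have hcast : (finrank ℝ L : ℝ) = finrank ℝ V - 1 := eq_sub_of_add_eq (by exact_mod_cast hL)
    rw [casoratiOn, casoratiSum_hyperplane hB _ e (by simpa using hL) ht htL, hcast]
  have : Nontrivial V := nontrivial_of_finrank_pos hV
  obtain ⟨t, ht, hmin⟩ := (isCompact_sphere (0 : V) 1).exists_isMinOn
    (NormedSpace.sphere_nonempty.2 zero_le_one) hq.continuousOn
  have ht1 : ‖t‖ = 1 := by simpa using ht
  have hL : finrank ℝ (ℝ ∙ t)ᗮ + 1 = finrank ℝ V := by
    rw [← (ℝ ∙ t).finrank_add_finrank_orthogonal,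
      finrank_span_singleton (norm_ne_zero_iff.1 (by simp [ht1])), add_comm]
  have htL : t ∈ (ℝ ∙ t)ᗮᗮ :=
    Submodule.le_orthogonal_orthogonal _ (Submodule.mem_span_singleton_self t)
  refine ⟨(ℝ ∙ t)ᗮ, hL, IsLeast.csInf_eq ⟨⟨_, hL, rfl⟩, ?_⟩⟩
  rintro _ ⟨L', hL', rfl⟩
  obtain ⟨t', ht'L, ht'⟩ := exists_unit_mem_orthogonal hL'
  rw [hcasorati hL ht1 htL, hcasorati hL' ht' ht'L]
  have hone : (1 : ℝ) ≤ finrank ℝ V := by exact_mod_cast hV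
  gcongr
  exact hmin (by simpa using ht')

lemma exists_eq_smul_of_casorati_eq (hB : ∀ u v, B u v = B v u) {n : ℕ} (hn : 2 ≤ n)
    (hV : finrank ℝ V = n) (e : OrthonormalBasis ι ℝ V)
    (h : (‖∑ i, B (e i) (e i)‖ ^ 2 - casoratiSum B e) / ((n : ℝ) * ((n : ℝ) - 1)) =
      1 / 2 * (1 / (n : ℝ) * casoratiSum B e) + ((n : ℝ) + 1) / (2 * n) *
        sInf {c : ℝ | ∃ L : Submodule ℝ V, finrank ℝ L + 1 = n ∧ c = casoratiOn B L}) :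
    ∃ (t : V) (η : W), ‖t‖ = 1 ∧ ∀ u v, B u v = (⟪u, v⟫ + ⟪u, t⟫ * ⟪v, t⟫) • η := by
  subst hV
  obtain ⟨L, hL, hmin⟩ := exists_sInf_casoratiOn_eq hB (by omega)
  obtain ⟨t, htL, ht⟩ := exists_unit_mem_orthogonal hL
  obtain ⟨e', rfl, he'⟩ := exists_orthonormalBasis_option (stdOrthonormalBasis ℝ L)
    (by simpa using hL) ht htL
  have : Nonempty (Fin (finrank ℝ L)) := ⟨⟨0, by omega⟩⟩
  obtain ⟨η, hη⟩ := exists_eq_smul_of_casorati_ideal hB e' (by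
    have hpos : (0 : ℝ) < finrank ℝ L := by exact_mod_cast (by omega : 0 < finrank ℝ L)
    rw [hmin, casoratiOn, sum_apply_self_eq B e e', casoratiSum_eq B e e', ← hL] at h
    push_cast at h
    simp only [add_sub_cancel_right] at h
    field_simp at h
    simp only [he', Fintype.card_fin]
    linarith)
  exact ⟨_, η, ht, hη⟩

end Algebra

section LocalRigidity

variable {V W : Type*} [NormedAddCommGroup V] [NormedSpace ℝ V] [NormedAddCommGroup W]
  [InnerProductSpace ℝ W] {Ω : Set V} {F G N N' : V → W} {y : V}

namespace FramedHypersurface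

variable [FiniteDimensional ℝ V]

lemma normalForm_eq_or_eq_neg (h : FramedHypersurface Ω F N) (h' : FramedHypersurface Ω G N')
    (hg : Set.EqOn (firstForm F) (firstForm G) Ω) (hV : 3 ≤ finrank ℝ V) (hy : y ∈ Ω)
    (hb : Function.Injective (normalForm F N y)) :
    normalForm F N y = normalForm G N' y ∨ normalForm F N y = normalForm G (-N') y := by
  have hgauss (u v w z : V) := h.gauss_congr h'.toIsImmersionOn hg hy u v w z
  simp only [h.secondForm_eq hy, h'.secondForm_eq hy,
    inner_smul_left, inner_smul_right, h.inner_normal_self hy, h'.inner_normal_self hy,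
    conj_trivial, mul_one] at hgauss
  have hinj : Function.Injective (normalForm F N y).toLinearMap₁₂ := fun u v huv ↦
    hb (by ext w; exact LinearMap.congr_fun huv w)
  have hminors (u v w z : V) :
      normalForm F N y u z * normalForm F N y v w - normalForm F N y u w * normalForm F N y v z =
        normalForm G N' y u z * normalForm G N' y v w -
          normalForm G N' y u w * normalForm G N' y v z := by
    linarith [hgauss u v w z]
  obtain heq | heq := eq_or_eq_neg_of_minors_eq (b' := (normalForm G N' y).toLinearMap₁₂) hinj hV
    hminors
  · exact .inl (by ext u v; exact (LinearMap.congr_fun₂ heq u v).symm)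
  · refine .inr ?_
    ext u v
    rw [normalForm_neg_apply]
    exact (neg_eq_iff_eq_neg.2 (LinearMap.congr_fun₂ heq u v)).symm

theorem beez_killing [FiniteDimensional ℝ W] (h : FramedHypersurface Ω F N)
    (h' : FramedHypersurface Ω G N') (hg : Set.EqOn (firstForm F) (firstForm G) Ω)
    (hV : 3 ≤ finrank ℝ V) (hΩ : IsPreconnected Ω)
    (hb : ∀ y ∈ Ω, Function.Injective (normalForm F N y)) :
    ∃ (O : W ≃ₗᵢ[ℝ] W) (c : W), ∀ y ∈ Ω, G y = O (F y) + c := by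
  have hsign (y : V) (hy : y ∈ Ω) := h.normalForm_eq_or_eq_neg h' hg hV hy (hb y hy)
  have hopen {N' : V → W} (h' : FramedHypersurface Ω G N') :
      IsOpen (Ω ∩ {y | normalForm F N y ≠ normalForm G N' y}) :=
    (h.continuousOn_normalForm.prodMk h'.continuousOn_normalForm).isOpen_inter_preimage h.isOpen
      isClosed_diagonal.isOpen_compl
  have hne {y : V} (hy : y ∈ Ω) (heq : normalForm F N y = normalForm G N' y) :
      normalForm F N y ≠ normalForm G (-N') y := fun hneg ↦ by
    have hV' : Nontrivial V := nontrivial_of_finrank_pos (R := ℝ) (by omega)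
    obtain ⟨u, hu⟩ := exists_ne (0 : V)
    refine hu (hb y hy ?_)
    ext v
    have hpos := congr($heq u v)
    have hminus := congr($hneg u v)
    rw [normalForm_neg_apply] at hminus
    rw [map_zero, zero_apply]
    linarith
  have hdisjoint : Disjoint (Ω ∩ {y | normalForm F N y ≠ normalForm G N' y})
      (Ω ∩ {y | normalForm F N y ≠ normalForm G (-N') y}) :=
    Set.disjoint_left.2 fun y ⟨hy, hpos⟩ ⟨_, hneg⟩ ↦ (hsign y hy).elim hpos hneg
  have hcover : Ω ⊆ Ω ∩ {y | normalForm F N y ≠ normalForm G N' y} ∪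
      Ω ∩ {y | normalForm F N y ≠ normalForm G (-N') y} := fun y hy ↦
    or_iff_not_imp_left.2 fun heq ↦ ⟨hy, hne hy (by_contra fun h ↦ heq ⟨hy, h⟩)⟩
  obtain hsub | hsub := hΩ.subset_or_subset (hopen h') (hopen h'.neg) hdisjoint hcover
  · exact exists_isometry_of_forms_eq h h'.neg hg
      (fun y hy ↦ (hsign y hy).resolve_left (hsub hy).2) hΩ
  · exact exists_isometry_of_forms_eq h h' hg
      (fun y hy ↦ (hsign y hy).resolve_right (hsub hy).2) hΩ

end FramedHypersurface

/-- The second fundamental form of an immersion `F` at a point has the algebraic shape of an ideal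
hypersurface: `h(u, v) = (g(u, v) + g(u, t) g(v, t)) η` with `t` a unit vector. -/
def HasIdealSecondForm (F : V → W) (y : V) : Prop :=
  ∃ (t : V) (η : W), ‖fderiv ℝ F y t‖ = 1 ∧ ∀ u v, secondForm F y u v =
    (⟪fderiv ℝ F y u, fderiv ℝ F y v⟫ +
      ⟪fderiv ℝ F y u, fderiv ℝ F y t⟫ * ⟪fderiv ℝ F y v, fderiv ℝ F y t⟫) • η

variable {a : ℝ} {T : W}

lemma HasIdealShape.normalForm_eq (hT : HasIdealShape F N a T y) (h : FramedHypersurface Ω F N)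
    (hy : y ∈ Ω) (u v : V) : normalForm F N y u v =
      a * (⟪fderiv ℝ F y u, fderiv ℝ F y v⟫ + ⟪fderiv ℝ F y u, T⟫ * ⟪fderiv ℝ F y v, T⟫) := by
  rw [normalForm_apply, h.weingarten hy, hT.fderiv_normal, inner_smul_right,
    inner_add_right, inner_smul_right, real_inner_comm (fderiv ℝ F y u)]
  ring

lemma HasIdealShape.normalForm_injective (hT : HasIdealShape F N a T y)
    (h : FramedHypersurface Ω F N) (hy : y ∈ Ω) (ha : a ≠ 0) :
    Function.Injective (normalForm F N y) := by
  refine (injective_iff_map_eq_zero _).2 fun u hu ↦ by_contra fun hne ↦ ?_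
  have huu : normalForm F N y u u = 0 := by rw [hu, zero_apply]
  rw [hT.normalForm_eq h hy, mul_eq_zero_iff_left ha] at huu
  have := h.inner_fderiv_self_pos hy hne
  have := mul_self_nonneg ⟪fderiv ℝ F y u, T⟫
  linarith

variable [FiniteDimensional ℝ V]

lemma HasIdealSecondForm.exists_hasIdealShape (hF : HasIdealSecondForm F y)
    (h : FramedHypersurface Ω F N) (hy : y ∈ Ω) : ∃ a T, HasIdealShape F N a T y := by
  obtain ⟨t, η, ht, hII⟩ := hF
  refine ⟨⟪η, N y⟫, fderiv ℝ F y t, ht, h.inner_fderiv_normal hy t, fun u ↦ ?_⟩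
  refine h.ext_inner hy (fun v ↦ ?_) ?_
  · have hform : normalForm F N y u v = ⟪secondForm F y u v, N y⟫ := by
      rw [h.secondForm_eq hy, inner_smul_left, h.inner_normal_self hy, mul_one, conj_trivial]
    rw [hII, inner_smul_left, conj_trivial, normalForm_apply,
      h.weingarten hy] at hform
    simp only [inner_smul_right, inner_add_right, real_inner_comm (fderiv ℝ F y u)] at hform ⊢
    linarith
  · simp [h.inner_normal_fderiv_normal hy, inner_smul_right, inner_add_right,
      h.inner_normal_fderiv hy]

lemma IsIdealOn.principalCurvature_eq_zero_iff [Nontrivial V] (hid : IsIdealOn Ω F N)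
    (h : FramedHypersurface Ω F N) (hy : y ∈ Ω) :
    principalCurvature F N y = 0 ↔ ∀ u v, secondForm F y u v = 0 := by
  obtain ⟨T, hT⟩ := hid.exists_hasIdealShape h hy
  refine ⟨fun ha u v ↦ ?_, fun hII ↦ by_contra fun ha ↦ ?_⟩
  · rw [h.secondForm_eq hy, hT.normalForm_eq h hy, ha, zero_mul, zero_smul]
  · obtain ⟨u, hu⟩ := exists_ne (0 : V)
    have hN : N y ≠ 0 := norm_ne_zero_iff.1 (by simp [h.norm_normal y hy])
    refine hu (hT.normalForm_injective h hy ha ?_)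
    ext v
    simpa [h.secondForm_eq hy, hN] using hII u v

lemma FramedHypersurface.eq_zero_of_comp_const {W' : Type*} [NormedAddCommGroup W']
    [NormedSpace ℝ W'] (h : FramedHypersurface Ω F N) (hy : y ∈ Ω) {A : W →L[ℝ] W'} {c : W'}
    (hA : ∀ z ∈ Ω, A (F z) = c) {u v : V} (huv : secondForm F y u v ≠ 0) : A = 0 := by
  have htangent (z : V) (hz : z ∈ Ω) (w : V) : A (fderiv ℝ F z w) = 0 :=
    DFunLike.congr_fun (hasFDerivAt_unique_of_eqOn h.isOpen hA hz
      (A.hasFDerivAt.comp z (h.hasFDerivAt hz)) (hasFDerivAt_const c z)) w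
  have hsecond : A (fderiv ℝ (fderiv ℝ F) y u v) = 0 :=
    DFunLike.congr_fun (hasFDerivAt_unique_of_eqOn h.isOpen (fun z hz ↦ htangent z hz v) hy
      (A.hasFDerivAt.comp y (h.hasFDerivAt_fderiv hy v)) (hasFDerivAt_const 0 y)) u
  have hnormal : A (N y) = 0 := by
    rw [← fderiv_connectionForm_add_secondForm, map_add, htangent y hy, zero_add,
      h.secondForm_eq hy, map_smul] at hsecond
    rw [h.secondForm_eq hy] at huv
    exact (smul_eq_zero.1 hsecond).resolve_left (left_ne_zero_of_smul huv)
  ext w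
  rw [← h.fderiv_tangentPart_add_normal hy w, map_add, map_smul, htangent y hy, hnormal, smul_zero,
    add_zero, zero_apply]

end LocalRigidity

/-! ### Immersions of manifolds in charts -/

section ChangeOfParameters

variable {V V' W : Type*} [NormedAddCommGroup V] [NormedSpace ℝ V] [NormedAddCommGroup V']
  [NormedSpace ℝ V'] [NormedAddCommGroup W] [InnerProductSpace ℝ W] [FiniteDimensional ℝ V]
  {Ω : Set V} {F : V → W} {y : V}

lemma IsImmersionOn.secondForm_eq_of_eq_fderiv_add (h : IsImmersionOn Ω F) (hy : y ∈ Ω)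
    {u v x : V} {w : W} (hw : ∀ z, ⟪w, fderiv ℝ F y z⟫ = 0)
    (hD : fderiv ℝ (fderiv ℝ F) y u v = fderiv ℝ F y x + w) : secondForm F y u v = w := by
  rw [secondForm, connectionForm, hD, map_add, h.tangentPart_fderiv hy, tangentPart_eq_zero hw,
    add_zero, add_sub_cancel_left]

lemma IsImmersionOn.secondForm_comp [FiniteDimensional ℝ V'] {Ω' : Set V'} {G : V' → W}
    {τ : V' → V} {y : V'} (h : IsImmersionOn Ω F) (h' : IsImmersionOn Ω' G)
    (hτ : ContDiffOn ℝ ∞ τ Ω') (hmaps : Set.MapsTo τ Ω' Ω) (hG : Set.EqOn G (F ∘ τ) Ω')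
    (hy : y ∈ Ω') (hsurj : Function.Surjective (fderiv ℝ τ y)) (u v : V') :
    secondForm G y u v = secondForm F (τ y) (fderiv ℝ τ y u) (fderiv ℝ τ y v) := by
  have hdτ {z : V'} (hz : z ∈ Ω') := hasFDerivAt_of_contDiffOn h'.isOpen hτ hz
  have hdG (z : V') (hz : z ∈ Ω') (v : V') :
      fderiv ℝ G z v = fderiv ℝ F (τ z) (fderiv ℝ τ z v) :=
    DFunLike.congr_fun (hasFDerivAt_unique_of_eqOn h'.isOpen hG hz (h'.hasFDerivAt hz)
      ((h.hasFDerivAt (hmaps hz)).comp z (hdτ hz))) v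
  have hddF := hasFDerivAt_of_contDiffOn h.isOpen (contDiffOn_fderiv h.isOpen h.contDiffOn)
    (hmaps hy)
  have hddG := DFunLike.congr_fun (hasFDerivAt_unique_of_eqOn h'.isOpen (fun z hz ↦ hdG z hz v) hy
    (h'.hasFDerivAt_fderiv hy v) ((hddF.comp y (hdτ hy)).clm_apply
      (hasFDerivAt_fderiv_apply h'.isOpen hτ hy v))) u
  obtain ⟨x, hx⟩ := hsurj (fderiv ℝ (fderiv ℝ τ) y u v +
    connectionForm F (τ y) (fderiv ℝ τ y u) (fderiv ℝ τ y v))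
  refine h'.secondForm_eq_of_eq_fderiv_add hy (x := x) (fun z ↦ ?_) ?_
  · rw [hdG y hy, h.inner_secondForm_fderiv (hmaps hy)]
  · rw [hdG y hy, hx, map_add, add_assoc, fderiv_connectionForm_add_secondForm]
    exact hddG

end ChangeOfParameters

section Charts

variable {n m : ℕ} {M : Type*} [TopologicalSpace M] [ChartedSpace (E n) M]

/-- The map `f` read in the chart at `x`. -/
def chartMap (f : M → E m) (x : M) : E n → E m := f ∘ (extChartAt (𝓡 n) x).symm

/-- The tangent vector with coordinates `u` in the chart at `x`, at the point with coordinates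
`y`. -/
def coordVector (x : M) (y : E n) : E n →L[ℝ] TangentSpace (𝓡 n) ((extChartAt (𝓡 n) x).symm y) :=
  mfderiv (𝓡 n) (𝓡 n) (extChartAt (𝓡 n) x).symm y

variable [IsManifold (𝓡 n) ∞ M] {f : M → E m} {x : M} {y : E n}

lemma isManifold_one : IsManifold (𝓡 n) 1 M := IsManifold.of_le (n := ∞) (by simp)

lemma hasMFDerivAt_extChartAt_symm (hy : y ∈ (extChartAt (𝓡 n) x).target) :
    HasMFDerivAt (𝓡 n) (𝓡 n) (extChartAt (𝓡 n) x).symm y (coordVector x y) := by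
  have := isManifold_one (n := n) (M := M)
  have h := mdifferentiableWithinAt_extChartAt_symm (I := 𝓡 n) hy
  rw [ModelWithCorners.Boundaryless.range_eq_univ, mdifferentiableWithinAt_univ] at h
  exact h.hasMFDerivAt

lemma isInvertible_coordVector (hy : y ∈ (extChartAt (𝓡 n) x).target) :
    (coordVector x y).IsInvertible := by
  have := isManifold_one (n := n) (M := M)
  have h := isInvertible_mfderivWithin_extChartAt_symm (I := 𝓡 n) hy
  rwa [ModelWithCorners.Boundaryless.range_eq_univ, mfderivWithin_univ] at h

lemma coord_surjective (x : M) : Function.Surjective (coord x : TangentSpace (𝓡 n) x → E n) := by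
  have := isManifold_one (n := n) (M := M)
  exact (isInvertible_mfderiv_extChartAt (I := 𝓡 n) (mem_extChartAt_source x)).surjective

section ContMDiff

variable (hf : ContMDiff (𝓡 n) (𝓡 m) ∞ f)

include hf

lemma contDiffOn_chartMap (x : M) : ContDiffOn ℝ ∞ (chartMap f x) (extChartAt (𝓡 n) x).target :=
  contMDiffOn_iff_contDiffOn.1 (hf.comp_contMDiffOn (contMDiffOn_extChartAt_symm x))

lemma fderiv_chartMap (hy : y ∈ (extChartAt (𝓡 n) x).target) (u : E n) :
    fderiv ℝ (chartMap f x) y u =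
      mfderiv (𝓡 n) (𝓡 m) f ((extChartAt (𝓡 n) x).symm y) (coordVector x y u) := by
  have hcomp := ((hf _).mdifferentiableAt (by simp)).hasMFDerivAt.comp y
    (hasMFDerivAt_extChartAt_symm hy)
  rw [← mfderiv_eq_fderiv]
  exact DFunLike.congr_fun hcomp.mfderiv u

end ContMDiff

lemma fderiv_extChartAt_comp_symm (hy : y ∈ (extChartAt (𝓡 n) x).target) (u : E n) :
    let z := (extChartAt (𝓡 n) x).symm y
    fderiv ℝ (extChartAt (𝓡 n) z ∘ (extChartAt (𝓡 n) x).symm) y u =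
      coord z (coordVector x y u) := by
  intro z
  have := isManifold_one (n := n) (M := M)
  have hcomp := (mdifferentiableAt_extChartAt (I := 𝓡 n) (mem_chart_source _ z)).hasMFDerivAt.comp y
    (hasMFDerivAt_extChartAt_symm hy)
  rw [← mfderiv_eq_fderiv]
  exact DFunLike.congr_fun hcomp.mfderiv u

variable [RiemannianBundle (fun x : M ↦ TangentSpace (𝓡 n) x)]

namespace IsIsometricImmersion

variable (hf : IsIsometricImmersion n f)

include hf

lemma firstForm_chartMap (hy : y ∈ (extChartAt (𝓡 n) x).target) (u v : E n) :
    firstForm (chartMap f x) y u v = inner ℝ (coordVector x y u) (coordVector x y v) := by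
  rw [firstForm_apply, fderiv_chartMap hf.1 hy, fderiv_chartMap hf.1 hy]
  exact hf.2 _ _ _

lemma isImmersionOn_chartMap (x : M) :
    IsImmersionOn (extChartAt (𝓡 n) x).target (chartMap f x) where
  isOpen := isOpen_extChartAt_target x
  contDiffOn := contDiffOn_chartMap hf.1 x
  injective y hy := by
    refine (injective_iff_map_eq_zero _).2 fun u hu ↦ ?_
    have huu := hf.firstForm_chartMap hy u u
    rw [firstForm_apply, hu, inner_zero_left] at huu
    exact (map_eq_zero_iff _ (isInvertible_coordVector hy).injective).1
      (inner_self_eq_zero.1 huu.symm)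

lemma secondFundamentalForm_eq (x : M) (u v : TangentSpace (𝓡 n) x) :
    secondFundamentalForm f x u v =
      secondForm (chartMap f x) (extChartAt (𝓡 n) x x) (coord x u) (coord x v) :=
  (secondForm_eq_starProjection (hf.isImmersionOn_chartMap x) (mem_extChartAt_target x) _ _).symm

lemma secondForm_chartMap (hy : y ∈ (extChartAt (𝓡 n) x).target) (u v : E n) :
    secondForm (chartMap f x) y u v = secondFundamentalForm f ((extChartAt (𝓡 n) x).symm y)
      (coordVector x y u) (coordVector x y v) := by
  set z := (extChartAt (𝓡 n) x).symm y
  set τ := extChartAt (𝓡 n) z ∘ (extChartAt (𝓡 n) x).symm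
  set Ω := (extChartAt (𝓡 n) x).target ∩ (extChartAt (𝓡 n) x).symm ⁻¹' (extChartAt (𝓡 n) z).source
  have hΩ : IsOpen Ω := (continuousOn_extChartAt_symm x).isOpen_inter_preimage
    (isOpen_extChartAt_target x) (isOpen_extChartAt_source z)
  have hτ : ContDiffOn ℝ ∞ τ Ω := contMDiffOn_iff_contDiffOn.1 <|
    (contMDiffOn_extChartAt (x := z)).comp
      ((contMDiffOn_extChartAt_symm x).mono Set.inter_subset_left)
      fun w hw ↦ by simpa only [extChartAt_source] using hw.2
  have hdτ : fderiv ℝ τ y = fun u ↦ coord z (coordVector x y u) :=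
    funext (fderiv_extChartAt_comp_symm hy)
  have hsurj : Function.Surjective (fderiv ℝ τ y) := by
    rw [hdτ]
    exact (coord_surjective z).comp (isInvertible_coordVector hy).surjective
  have hcomp := (hf.isImmersionOn_chartMap z).secondForm_comp
    ((hf.isImmersionOn_chartMap x).mono hΩ Set.inter_subset_left) hτ
    (fun w hw ↦ (extChartAt (𝓡 n) z).map_source hw.2)
    (fun w hw ↦ congrArg f ((extChartAt (𝓡 n) z).left_inv hw.2).symm)
    ⟨hy, mem_extChartAt_source z⟩ hsurj u v
  rw [hcomp, hf.secondFundamentalForm_eq, hdτ]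
  rfl

end IsIsometricImmersion

end Charts

section StdVec

variable {n : ℕ}

lemma sum_smul_stdVec (u : E n) : ∑ i, u i • stdVec i = u := by
  simpa [stdVec] using (EuclideanSpace.basisFun (Fin n) ℝ).sum_repr u

lemma sum_mul_apply_stdVec (φ : E n →ₗ[ℝ] ℝ) (u : E n) : ∑ i, u i * φ (stdVec i) = φ u := by
  conv_rhs => rw [← sum_smul_stdVec u]
  simp

variable {W : Type*} [NormedAddCommGroup W] [InnerProductSpace ℝ W]

lemma sum_mul_curvature_stdVec (B : E n →ₗ[ℝ] E n →ₗ[ℝ] W) (u v w z : E n) :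
    ∑ j, w j * ∑ k, u k * ∑ l, v l * ∑ m, z m *
        (⟪B (stdVec l) (stdVec j), B (stdVec k) (stdVec m)⟫ -
          ⟪B (stdVec k) (stdVec j), B (stdVec l) (stdVec m)⟫) =
      ⟪B v w, B u z⟫ - ⟪B u w, B v z⟫ := by
  have hz (a b c : E n) : ∑ m, z m * (⟪B b c, B a (stdVec m)⟫ - ⟪B a c, B b (stdVec m)⟫) =
      ⟪B b c, B a z⟫ - ⟪B a c, B b z⟫ :=
    sum_mul_apply_stdVec (innerₛₗ ℝ (B b c) ∘ₗ B a - innerₛₗ ℝ (B a c) ∘ₗ B b) z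
  have hv (a c : E n) : ∑ l, v l * (⟪B (stdVec l) c, B a z⟫ - ⟪B a c, B (stdVec l) z⟫) =
      ⟪B v c, B a z⟫ - ⟪B a c, B v z⟫ :=
    sum_mul_apply_stdVec
      ((innerₛₗ ℝ).flip (B a z) ∘ₗ B.flip c - innerₛₗ ℝ (B a c) ∘ₗ B.flip z) v
  have hu (c : E n) : ∑ k, u k * (⟪B v c, B (stdVec k) z⟫ - ⟪B (stdVec k) c, B v z⟫) =
      ⟪B v c, B u z⟫ - ⟪B u c, B v z⟫ :=
    sum_mul_apply_stdVec
      (innerₛₗ ℝ (B v c) ∘ₗ B.flip z - (innerₛₗ ℝ).flip (B v z) ∘ₗ B.flip c) u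
  simp only [hz, hv, hu]
  exact sum_mul_apply_stdVec
    ((innerₛₗ ℝ).flip (B u z) ∘ₗ B v - (innerₛₗ ℝ).flip (B v z) ∘ₗ B u) w

end StdVec

/-- The second fundamental form of a map between vector spaces, as a bilinear map. -/
def secondFormBilin {V W : Type*} [NormedAddCommGroup V] [NormedSpace ℝ V] [NormedAddCommGroup W]
    [InnerProductSpace ℝ W] (F : V → W) (y : V) : V →ₗ[ℝ] V →ₗ[ℝ] W :=
  (fderiv ℝ (fderiv ℝ F) y).toLinearMap₁₂.compr₂
    (LinearMap.id - (fderiv ℝ F y).toLinearMap ∘ₗ (tangentPart F y).toLinearMap)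

section Curvature

variable {n m : ℕ} {M : Type*} [TopologicalSpace M] [ChartedSpace (E n) M]
  [IsManifold (𝓡 n) ∞ M] [RiemannianBundle (fun x : M ↦ TangentSpace (𝓡 n) x)]
  {f : M → E m} {x : M} {y : E n}

namespace IsIsometricImmersion

variable (hf : IsIsometricImmersion n f)

include hf

lemma metricMatrix_eq (hy : y ∈ (extChartAt (𝓡 n) x).target) (i j : Fin n) :
    metricMatrix x y i j = firstForm (chartMap f x) y (stdVec i) (stdVec j) :=
  (hf.firstForm_chartMap hy _ _).symm

lemma metricMatrix_mulVec (hy : y ∈ (extChartAt (𝓡 n) x).target) (c : E n) (l : Fin n) :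
    (metricMatrix x y).mulVec c l = firstForm (chartMap f x) y c (stdVec l) := by
  simp only [Matrix.mulVec, dotProduct, hf.metricMatrix_eq hy, mul_comm _ (c _)]
  have h := sum_mul_apply_stdVec (firstForm (chartMap f x) y (stdVec l)).toLinearMap c
  simp only [ContinuousLinearMap.coe_coe, firstForm_apply] at h ⊢
  rw [h, real_inner_comm]

lemma isUnit_metricMatrix (hy : y ∈ (extChartAt (𝓡 n) x).target) : IsUnit (metricMatrix x y) := by
  rw [← Matrix.mulVec_injective_iff_isUnit, ← Matrix.coe_mulVecLin, injective_iff_map_eq_zero]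
  intro c hc
  set v : E n := WithLp.toLp 2 c
  have hv : firstForm (chartMap f x) y v = 0 := by
    ext w
    refine (sum_mul_apply_stdVec (firstForm (chartMap f x) y v).toLinearMap w).symm.trans ?_
    exact Finset.sum_eq_zero fun l _ ↦
      mul_eq_zero_of_right _ ((hf.metricMatrix_mulVec hy v l).symm.trans (congrFun hc l))
  by_contra hne
  have hv' : v ≠ 0 := by simpa [v] using hne
  have hpos := (hf.isImmersionOn_chartMap x).inner_fderiv_self_pos hy hv'
  rw [← firstForm_apply, hv] at hpos
  exact hpos.false

lemma partialDeriv_metricMatrix (hy : y ∈ (extChartAt (𝓡 n) x).target) (i j l : Fin n) :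
    partialDeriv i (fun z ↦ metricMatrix x z j l) y =
      fderiv ℝ (fun z ↦ firstForm (chartMap f x) z (stdVec j) (stdVec l)) y (stdVec i) := by
  have heq : Set.EqOn (fun z ↦ metricMatrix x z j l)
      (fun z ↦ firstForm (chartMap f x) z (stdVec j) (stdVec l)) (extChartAt (𝓡 n) x).target :=
    fun z hz ↦ hf.metricMatrix_eq hz j l
  rw [partialDeriv,
    (heq.eventuallyEq_of_mem ((isOpen_extChartAt_target x).mem_nhds hy)).fderiv_eq]

lemma christoffel_eq (hy : y ∈ (extChartAt (𝓡 n) x).target) (k i j : Fin n) :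
    christoffel x k i j y = connectionForm (chartMap f x) y (stdVec i) (stdVec j) k := by
  have h := hf.isImmersionOn_chartMap x
  set γ := connectionForm (chartMap f x) y (stdVec i) (stdVec j) with hγ
  have hkoszul (l : Fin n) : 2 * (metricMatrix x y).mulVec γ l =
      partialDeriv i (fun z ↦ metricMatrix x z j l) y +
        partialDeriv j (fun z ↦ metricMatrix x z i l) y -
        partialDeriv l (fun z ↦ metricMatrix x z i j) y := by
    simp only [hf.partialDeriv_metricMatrix hy]
    rw [hf.metricMatrix_mulVec hy, ← h.koszul hy, hγ, connectionForm,
      h.firstForm_tangentPart hy, pullbackCovector_apply]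
  have hinv : (metricMatrix x y)⁻¹.mulVec ((metricMatrix x y).mulVec γ) = γ := by
    rw [Matrix.mulVec_mulVec, Matrix.nonsing_inv_mul _
      ((Matrix.isUnit_iff_isUnit_det _).1 (hf.isUnit_metricMatrix hy)), Matrix.one_mulVec]
  rw [← congrFun hinv k, christoffel, Matrix.mulVec, dotProduct, Finset.mul_sum]
  refine Finset.sum_congr rfl fun l _ ↦ ?_
  rw [← hkoszul]
  ring

lemma partialDeriv_christoffel (hy : y ∈ (extChartAt (𝓡 n) x).target) (k i l j : Fin n) :
    partialDeriv k (christoffel x i l j) y =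
      fderiv ℝ (fun z ↦ connectionForm (chartMap f x) z (stdVec l) (stdVec j)) y (stdVec k) i := by
  have heq : Set.EqOn (christoffel x i l j) ((EuclideanSpace.proj i : E n →L[ℝ] ℝ) ∘
      fun z ↦ connectionForm (chartMap f x) z (stdVec l) (stdVec j)) (extChartAt (𝓡 n) x).target :=
    fun z hz ↦ hf.christoffel_eq hz i l j
  have hd := (EuclideanSpace.proj i : E n →L[ℝ] ℝ).hasFDerivAt.comp y
    ((hf.isImmersionOn_chartMap x).hasFDerivAt_connectionForm hy (stdVec l) (stdVec j))
  rw [partialDeriv,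
    (heq.eventuallyEq_of_mem ((isOpen_extChartAt_target x).mem_nhds hy)).fderiv_eq, hd.fderiv]
  rfl

lemma curvatureCoeff_eq (x : M) (i j k l : Fin n) : curvatureCoeff x i j k l =
    curvatureForm (chartMap f x) (extChartAt (𝓡 n) x x) (stdVec k) (stdVec l) (stdVec j) i := by
  have hp : extChartAt (𝓡 n) x x ∈ (extChartAt (𝓡 n) x).target := mem_extChartAt_target x
  set p := extChartAt (𝓡 n) x x with hp'
  have hsum (u w : E n) : connectionForm (chartMap f x) p u w i =
      ∑ r, connectionForm (chartMap f x) p u (stdVec r) i * w r := by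
    simp only [mul_comm _ (w _)]
    exact (sum_mul_apply_stdVec ((EuclideanSpace.proj (𝕜 := ℝ) i).toLinearMap ∘ₗ
      (tangentPart (chartMap f x) p).toLinearMap ∘ₗ
        (fderiv ℝ (fderiv ℝ (chartMap f x)) p u).toLinearMap) w).symm
  simp only [curvatureCoeff, ← hp', hf.partialDeriv_christoffel hp, hf.christoffel_eq hp,
    Finset.sum_sub_distrib, ← hsum]
  rfl

theorem curvatureTensor_eq (u v w z : TangentSpace (𝓡 n) x) : curvatureTensor x u v w z =
    ⟪secondFundamentalForm f x v w, secondFundamentalForm f x u z⟫ -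
      ⟪secondFundamentalForm f x u w, secondFundamentalForm f x v z⟫ := by
  set p := extChartAt (𝓡 n) x x
  set B := secondFormBilin (chartMap f x) p
  have hp' : p ∈ (extChartAt (𝓡 n) x).target := mem_extChartAt_target x
  have hgauss (j k l r : Fin n) : ∑ i, metricMatrix x p r i * curvatureCoeff x i j k l =
      ⟪B (stdVec l) (stdVec j), B (stdVec k) (stdVec r)⟫ -
        ⟪B (stdVec k) (stdVec j), B (stdVec l) (stdVec r)⟫ := by
    simp only [hf.curvatureCoeff_eq]
    refine (hf.metricMatrix_mulVec hp' _ r).trans ?_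
    rw [firstForm_apply]
    exact (hf.isImmersionOn_chartMap x).gauss hp' _ _ _ _
  have hsum : curvatureTensor x u v w z = ∑ j, coord x w j * ∑ k, coord x u k * ∑ l, coord x v l *
      ∑ r, coord x z r * ∑ i, metricMatrix x p r i * curvatureCoeff x i j k l := by
    simp only [Finset.mul_sum]
    rw [curvatureTensor, Finset.sum_comm]
    refine Finset.sum_congr rfl fun j _ ↦ ?_
    rw [Finset.sum_comm]
    refine Finset.sum_congr rfl fun k _ ↦ ?_
    rw [Finset.sum_comm]
    refine Finset.sum_congr rfl fun l _ ↦ ?_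
    rw [Finset.sum_comm]
    refine Finset.sum_congr rfl fun r _ ↦ Finset.sum_congr rfl fun i _ ↦ ?_
    ring
  simp only [hsum, hgauss, sum_mul_curvature_stdVec, hf.secondFundamentalForm_eq]
  rfl

end IsIsometricImmersion

end Curvature

lemma two_mul_sum_lt {ι : Type*} [Fintype ι] [LinearOrder ι] {S : ι → ι → ℝ}
    (hS : ∀ i j, S i j = S j i) (hdiag : ∀ i, S i i = 0) :
    2 * ∑ i, ∑ j, (if i < j then S i j else 0) = ∑ i, ∑ j, S i j := by
  have hsplit (i j : ι) :
      S i j = (if i < j then S i j else 0) + if j < i then S j i else 0 := by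
    rcases lt_trichotomy i j with h | rfl | h
    · simp [h, h.le]
    · simp [hdiag]
    · simp [h, h.le, hS i j]
  rw [Finset.sum_congr rfl fun i _ ↦ Finset.sum_congr rfl fun j _ ↦ hsplit i j]
  simp only [Finset.sum_add_distrib]
  rw [Finset.sum_comm (f := fun i j ↦ if j < i then S j i else 0), two_mul]

section Casorati

variable {n m : ℕ} {M : Type*} [TopologicalSpace M] [ChartedSpace (E n) M]

variable (n) in
/-- The second fundamental form at `x`, as a bilinear map on the tangent space. -/
def secondFundamentalBilin (f : M → E m) (x : M) :
    TangentSpace (𝓡 n) x →ₗ[ℝ] TangentSpace (𝓡 n) x →ₗ[ℝ] E m :=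
  let dφ : TangentSpace (𝓡 n) x →ₗ[ℝ] E n :=
    (mfderiv (𝓡 n) (𝓡 n) (extChartAt (𝓡 n) x) x).toLinearMap
  (secondFormBilin (chartMap f x) (extChartAt (𝓡 n) x x)).compl₁₂ dφ dφ

variable (n) in
/-- A geodesic point of a map into Euclidean space: its second fundamental form vanishes there. -/
def IsGeodesicPoint (f : M → E m) (x : M) : Prop :=
  ∀ u v : TangentSpace (𝓡 n) x, secondFundamentalForm f x u v = 0

variable [IsManifold (𝓡 n) ∞ M] [RiemannianBundle (fun x : M ↦ TangentSpace (𝓡 n) x)]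
  {f : M → E m} {x : M}

namespace IsIsometricImmersion

variable (hf : IsIsometricImmersion n f)

include hf

lemma secondFundamentalBilin_apply (x : M) (u v : TangentSpace (𝓡 n) x) :
    secondFundamentalBilin n f x u v = secondFundamentalForm f x u v :=
  (hf.secondFundamentalForm_eq x u v).symm

lemma secondFundamentalForm_comm (u v : TangentSpace (𝓡 n) x) :
    secondFundamentalForm f x u v = secondFundamentalForm f x v u := by
  rw [hf.secondFundamentalForm_eq, hf.secondFundamentalForm_eq, secondForm, secondForm,
    connectionForm, connectionForm,
    (hf.isImmersionOn_chartMap x).fderiv_fderiv_comm (mem_extChartAt_target x)]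

lemma sectionalCurvature_eq {u v : TangentSpace (𝓡 n) x} (hu : ‖u‖ = 1) (hv : ‖v‖ = 1)
    (huv : ⟪u, v⟫ = 0) : sectionalCurvature x u v =
      ⟪secondFundamentalForm f x u u, secondFundamentalForm f x v v⟫ -
        ‖secondFundamentalForm f x u v‖ ^ 2 := by
  rw [sectionalCurvature, hf.curvatureTensor_eq, real_inner_self_eq_norm_sq,
    real_inner_self_eq_norm_sq, hu, hv, huv, hf.secondFundamentalForm_comm v u,
    real_inner_self_eq_norm_sq, real_inner_comm]
  norm_num

lemma normalizedScalarCurvature_eq (x : M) :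
    let e := stdOrthonormalBasis ℝ (TangentSpace (𝓡 n) x)
    normalizedScalarCurvature n x =
      (‖∑ i, secondFundamentalBilin n f x (e i) (e i)‖ ^ 2 -
        casoratiSum (secondFundamentalBilin n f x) e) / ((n : ℝ) * ((n : ℝ) - 1)) := by
  intro e
  set B := secondFundamentalBilin n f x
  have hB (i j : Fin _) : B (e i) (e j) = secondFundamentalForm f x (e i) (e j) :=
    hf.secondFundamentalBilin_apply x _ _
  have hK (i j : Fin _) : (if i < j then sectionalCurvature x (e i) (e j) else 0) =
      if i < j then ⟪B (e i) (e i), B (e j) (e j)⟫ - ‖B (e i) (e j)‖ ^ 2 else 0 := by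
    split_ifs with hij
    · rw [hf.sectionalCurvature_eq (e.norm_eq_one i) (e.norm_eq_one j)
        (e.inner_eq_zero hij.ne), hB, hB, hB]
    · rfl
  rw [normalizedScalarCurvature, scalarCurvature]
  simp only [e, hK]
  rw [two_mul_sum_lt, casoratiSum, ← real_inner_self_eq_norm_sq, sum_inner]
  · simp only [inner_sum, Finset.sum_sub_distrib]
  · intro i j
    rw [real_inner_comm, hB i j, hB j i, hf.secondFundamentalForm_comm]
  · intro i
    rw [real_inner_self_eq_norm_sq, sub_self]

lemma deltaCasorati_eq (x : M) : deltaCasorati n f x =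
    1 / 2 * (1 / (n : ℝ) * casoratiSum (secondFundamentalBilin n f x)
        (stdOrthonormalBasis ℝ (TangentSpace (𝓡 n) x))) +
      ((n : ℝ) + 1) / (2 * n) * sInf {c : ℝ | ∃ L : Submodule ℝ (TangentSpace (𝓡 n) x),
        finrank ℝ L + 1 = n ∧ c = casoratiOn (secondFundamentalBilin n f x) L} := by
  simp only [deltaCasorati, casoratiCurvature, casoratiCurvatureOn, casoratiOn, casoratiSum,
    hf.secondFundamentalBilin_apply]

theorem exists_secondFundamentalForm_eq_smul (hid : IsCasoratiIdeal n f) (hn : 2 ≤ n) (x : M) :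
    ∃ (t : TangentSpace (𝓡 n) x) (η : E m), ‖t‖ = 1 ∧
      ∀ u v : TangentSpace (𝓡 n) x,
        secondFundamentalForm f x u v = (⟪u, v⟫ + ⟪u, t⟫ * ⟪v, t⟫) • η := by
  have hsymm (u v : TangentSpace (𝓡 n) x) : secondFundamentalBilin n f x u v =
      secondFundamentalBilin n f x v u := by
    rw [hf.secondFundamentalBilin_apply, hf.secondFundamentalForm_comm,
      hf.secondFundamentalBilin_apply]
  simp only [← hf.secondFundamentalBilin_apply]
  exact exists_eq_smul_of_casorati_eq hsymm hn finrank_euclideanSpace_fin _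
    ((hf.normalizedScalarCurvature_eq x).symm.trans ((hid x).trans (hf.deltaCasorati_eq x)))

lemma hasIdealSecondForm_chartMap (hid : IsCasoratiIdeal n f) (hn : 2 ≤ n) {y : E n}
    (hy : y ∈ (extChartAt (𝓡 n) x).target) : HasIdealSecondForm (chartMap f x) y := by
  obtain ⟨t, η, ht, hη⟩ :=
    hf.exists_secondFundamentalForm_eq_smul hid hn ((extChartAt (𝓡 n) x).symm y)
  obtain ⟨w, rfl⟩ := (isInvertible_coordVector hy).surjective t
  have hinner (u v : E n) : ⟪fderiv ℝ (chartMap f x) y u, fderiv ℝ (chartMap f x) y v⟫ =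
      inner ℝ (coordVector x y u) (coordVector x y v) := hf.firstForm_chartMap hy u v
  refine ⟨w, η, ?_, fun u v ↦ ?_⟩
  · rw [norm_eq_sqrt_real_inner, hinner, ← norm_eq_sqrt_real_inner, ht]
  · rw [hf.secondForm_chartMap hy, hη, hinner, hinner, hinner]

lemma secondForm_chartMap_eq_zero_iff {y : E n} (hy : y ∈ (extChartAt (𝓡 n) x).target) :
    (∀ u v, secondForm (chartMap f x) y u v = 0) ↔
      IsGeodesicPoint n f ((extChartAt (𝓡 n) x).symm y) := by
  have hsurj := (isInvertible_coordVector hy).surjective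
  simp only [IsGeodesicPoint, hf.secondForm_chartMap hy, hsurj.forall]

end IsIsometricImmersion

end Casorati

section Global

variable {n : ℕ} {M : Type*} [TopologicalSpace M] [ChartedSpace (E n) M]

variable (n) in
lemma eventually_exists_mem_ball {r : ℝ} (hr : 0 < r) (x : M) :
    ∀ᶠ z in 𝓝 x, ∃ y ∈ Metric.ball (extChartAt (𝓡 n) x x) r, (extChartAt (𝓡 n) x).symm y = z := by
  filter_upwards [extChartAt_source_mem_nhds (I := 𝓡 n) x,
    continuousAt_extChartAt (I := 𝓡 n) x (Metric.ball_mem_nhds _ hr)] with z hz hzr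
  exact ⟨_, hzr, (extChartAt (𝓡 n) x).left_inv hz⟩

variable [IsManifold (𝓡 n) ∞ M] [RiemannianBundle (fun x : M ↦ TangentSpace (𝓡 n) x)]
  {f f' : M → E (n + 1)} {x : M}

namespace IsIsometricImmersion

variable (hf : IsIsometricImmersion n f)

include hf

lemma eventually_framedHypersurface (x : M) : ∀ᶠ r in 𝓝[>] 0,
    Metric.ball (extChartAt (𝓡 n) x x) r ⊆ (extChartAt (𝓡 n) x).target ∧
      ∃ N, FramedHypersurface (Metric.ball (extChartAt (𝓡 n) x x) r) (chartMap f x) N := by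
  obtain ⟨Ω, hΩ, hx, N, hN⟩ := (hf.isImmersionOn_chartMap x).exists_framedHypersurface
    (by simp) (mem_extChartAt_target x)
  obtain ⟨R, hR, hball⟩ := Metric.isOpen_iff.1 hN.isOpen _ hx
  filter_upwards [Ioc_mem_nhdsGT hR] with r hr
  have hr' := (Metric.ball_subset_ball hr.2).trans hball
  exact ⟨hr'.trans hΩ, N, hN.mono Metric.isOpen_ball hr'⟩

lemma eq_of_eventually_isometry_eq (hx : ¬IsGeodesicPoint n f x)
    {O O' : E (n + 1) ≃ₗᵢ[ℝ] E (n + 1)} {c c' : E (n + 1)}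
    (h : ∀ᶠ z in 𝓝 x, O (f z) + c = O' (f z) + c') : O = O' ∧ c = c' := by
  have hsymm := continuousAt_extChartAt_symm (I := 𝓡 n) x
  rw [ContinuousAt, extChartAt_to_inv] at hsymm
  obtain ⟨R, hR, heq⟩ := Metric.eventually_nhds_iff_ball.1 (hsymm.eventually h)
  obtain ⟨r, ⟨-, N, hN⟩, hr⟩ :=
    ((hf.eventually_framedHypersurface x).and (Ioc_mem_nhdsGT hR)).exists
  obtain ⟨u, v, huv⟩ : ∃ u v, secondForm (chartMap f x) (extChartAt (𝓡 n) x x) u v ≠ 0 := by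
    rw [← extChartAt_to_inv (I := 𝓡 n) x,
      ← hf.secondForm_chartMap_eq_zero_iff (mem_extChartAt_target x)] at hx
    push Not at hx
    exact hx
  have hA : (O : E (n + 1) →L[ℝ] E (n + 1)) - (O' : E (n + 1) →L[ℝ] E (n + 1)) = 0 :=
    hN.eq_zero_of_comp_const (c := c' - c) (Metric.mem_ball_self hr.1)
      (fun z hz ↦ sub_eq_sub_iff_add_eq_add.2
        ((heq z (Metric.ball_subset_ball hr.2 hz)).trans (add_comm _ _))) huv
  have hO : O = O' := LinearIsometryEquiv.ext fun w ↦ DFunLike.congr_fun (sub_eq_zero.1 hA) w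
  subst hO
  exact ⟨rfl, add_left_cancel h.self_of_nhds⟩

variable (hid : IsCasoratiIdeal n f) (hn : 3 ≤ n)

include hid hn

lemma isIdealOn_chartMap {Ω : Set (E n)} {N : E n → E (n + 1)}
    (hN : FramedHypersurface Ω (chartMap f x) N) (hΩ : Ω ⊆ (extChartAt (𝓡 n) x).target) :
    IsIdealOn Ω (chartMap f x) N := fun _ hy ↦
  (hf.hasIdealSecondForm_chartMap hid (by lia) (hΩ hy)).exists_hasIdealShape hN hy

lemma principalCurvature_chartMap_eq_zero_iff {Ω : Set (E n)} {N : E n → E (n + 1)}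
    (hN : FramedHypersurface Ω (chartMap f x) N) (hΩ : Ω ⊆ (extChartAt (𝓡 n) x).target) {y : E n}
    (hy : y ∈ Ω) : principalCurvature (chartMap f x) N y = 0 ↔
      IsGeodesicPoint n f ((extChartAt (𝓡 n) x).symm y) := by
  have : Nontrivial (E n) := Module.nontrivial_of_finrank_pos (R := ℝ) <| by
    rw [finrank_euclideanSpace_fin]
    lia
  rw [(hf.isIdealOn_chartMap hid hn hN hΩ).principalCurvature_eq_zero_iff hN hy,
    hf.secondForm_chartMap_eq_zero_iff (hΩ hy)]

lemma eventually_isGeodesicPoint_iff (x : M) :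
    ∀ᶠ z in 𝓝 x, IsGeodesicPoint n f z ↔ IsGeodesicPoint n f x := by
  obtain ⟨r, ⟨hΩ, N, hN⟩, hr⟩ :=
    ((hf.eventually_framedHypersurface x).and self_mem_nhdsWithin).exists
  have hzero {p y : E n} (hp : p ∈ Metric.ball (extChartAt (𝓡 n) x x) r)
      (hy : y ∈ Metric.ball (extChartAt (𝓡 n) x x) r)
      (hgeo : IsGeodesicPoint n f ((extChartAt (𝓡 n) x).symm p)) :
      IsGeodesicPoint n f ((extChartAt (𝓡 n) x).symm y) := by
    rw [← hf.principalCurvature_chartMap_eq_zero_iff hid hn hN hΩ] at hgeo ⊢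
    · exact hN.principalCurvature_eq_zero (hf.isIdealOn_chartMap hid hn hN hΩ) (by simpa using hn)
        (convex_ball _ _).isPreconnected hp hgeo hy
    all_goals assumption
  have hx := Metric.mem_ball_self (x := extChartAt (𝓡 n) x x) hr
  filter_upwards [eventually_exists_mem_ball n hr x] with z ⟨y, hy, hyz⟩
  rw [← hyz]
  conv_rhs => rw [← extChartAt_to_inv (I := 𝓡 n) x]
  exact ⟨hzero hy hx, hzero hx hy⟩

lemma not_isGeodesicPoint [PreconnectedSpace M] (hne : ¬IsTotallyGeodesic n f) (x : M) :
    ¬IsGeodesicPoint n f x := by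
  refine fun hx ↦ hne fun z ↦ ?_
  have hloc : IsLocallyConstant (IsGeodesicPoint n f) :=
    (IsLocallyConstant.iff_eventually_eq _).2 fun x ↦
      (hf.eventually_isGeodesicPoint_iff hid hn x).mono fun _ ↦ propext
  exact (hloc.apply_eq_of_preconnectedSpace x z).mp hx

lemma exists_eventually_eq_isometry (hf' : IsIsometricImmersion n f')
    (hgeo : ∀ x, ¬IsGeodesicPoint n f x) (x : M) :
    ∃ (O : E (n + 1) ≃ₗᵢ[ℝ] E (n + 1)) (c : E (n + 1)), ∀ᶠ z in 𝓝 x, f' z = O (f z) + c := by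
  obtain ⟨r, ⟨⟨hΩ, N, hN⟩, -, N', hN'⟩, hr⟩ := (((hf.eventually_framedHypersurface x).and
    (hf'.eventually_framedHypersurface x)).and self_mem_nhdsWithin).exists
  obtain ⟨O, c, hO⟩ := hN.beez_killing hN'
    (fun y hy ↦ by
      ext u v
      rw [hf.firstForm_chartMap (hΩ hy), hf'.firstForm_chartMap (hΩ hy)])
    (by simpa using hn) (convex_ball _ _).isPreconnected
    (fun y hy ↦ by
      obtain ⟨T, hT⟩ := (hf.isIdealOn_chartMap hid hn hN hΩ).exists_hasIdealShape hN hy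
      refine hT.normalForm_injective hN hy ?_
      rw [Ne, hf.principalCurvature_chartMap_eq_zero_iff hid hn hN hΩ hy]
      exact hgeo _)
  refine ⟨O, c, (eventually_exists_mem_ball n hr x).mono ?_⟩
  rintro _ ⟨y, hy, rfl⟩
  exact hO y hy

end IsIsometricImmersion

end Global

end Casorati

end

theorem theorem5p5_general {n : ℕ} (hn : 3 ≤ n) {M : Type*} [TopologicalSpace M]
    [PreconnectedSpace M] [ChartedSpace (Casorati.E n) M] [IsManifold (𝓡 n) ∞ M]
    [RiemannianBundle (fun x : M ↦ TangentSpace (𝓡 n) x)]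
    (f : M → Casorati.E (n + 1)) (hf : Casorati.IsIsometricImmersion n f)
    (hideal : Casorati.IsCasoratiIdeal n f) (hnontrivial : ¬ Casorati.IsTotallyGeodesic n f) :
    Casorati.IsRigid n f := by
  intro f' hf'
  have hgeo := hf.not_isGeodesicPoint hideal hn hnontrivial
  choose O c hO using hf.exists_eventually_eq_isometry hideal hn hf' hgeo
  have hloc : IsLocallyConstant fun x ↦ (O x, c x) := by
    refine (IsLocallyConstant.iff_eventually_eq _).2 fun x ↦ ?_
    filter_upwards [(hO x).eventually_nhds] with y hy
    exact Prod.ext_iff.2 <| hf.eq_of_eventually_isometry_eq (hgeo y) <| by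
      filter_upwards [hO y, hy] with z hz hz'
      exact hz.symm.trans hz'
  obtain ⟨x₀, -⟩ := not_forall.1 hnontrivial
  refine ⟨(O x₀).toIsometryEquiv.trans (IsometryEquiv.addRight (c x₀)), fun x ↦ ?_⟩
  obtain ⟨hOx, hcx⟩ := Prod.mk.inj (hloc.apply_eq_of_preconnectedSpace x x₀)
  rw [(hO x).self_of_nhds, hOx, hcx]
  rfl

theorem theorem5p5 {M : Type*} [TopologicalSpace M] [ConnectedSpace M]
    [ChartedSpace (Casorati.E 3) M] [IsManifold (𝓡 3) ∞ M]
    [RiemannianBundle (fun x : M ↦ TangentSpace (𝓡 3) x)]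
    [IsContMDiffRiemannianBundle (𝓡 3) ∞ (Casorati.E 3) (fun x : M ↦ TangentSpace (𝓡 3) x)]
    (f : M → Casorati.E 4) (hf : Casorati.IsIsometricImmersion 3 f)
    (hideal : Casorati.IsCasoratiIdeal 3 f) (hnontrivial : ¬ Casorati.IsTotallyGeodesic 3 f) :
    Casorati.IsRigid 3 f :=
  theorem5p5_general le_rfl f hf hideal hnontrivial
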